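/- Let $\gamma,\lambda,\mu>0$. Let $H_\gamma$ be the operator in $L^2(\mathbb R)$ (complex-valued functions) with domain $$D(H_\gamma)=\{\psi\in H^2(\mathbb R\setminus\{0\}):\ \psi'(0^+)=\psi'(0^-),\ \psi(0^+)-\psi(0^-)=-\gamma\,\psi'(0^+)\}$$ and action $H_\gamma\psi=-\psi''$ on $\mathbb R\setminus\{0\}$ (the attractive $\delta'$ interaction). Let $Q=H^1(\mathbb R^+)\oplus H^1(\mathbb R^-)$, with norm $\|\psi\|_Q^2=\|\psi\|^2+\|\psi'\|^2$, where $\|\cdot\|$ is the $L^2$-norm and $\psi'$ is the weak derivative on $\mathbb R\setminus\{0\}$, and let $Q^\star$ be its dual, in which $Q$ is embedded through the $L^2$ scalar product. Then $H_\gamma$ generates a strongly continuous unitary group $(e^{-iH_\gamma t})_{t\in\mathbb R}$ on $L^2(\mathbb R)$, with generator exactly $-iH_\gamma$, and for every $\psi_0\in Q$ the following hold for the equation $$\psi(t)=e^{-iH_\gamma t}\psi_0+i\lambda\int_0^t e^{-iH_\gamma(t-s)}\,|\psi(s)|^{2\mu}\psi(s)\,ds .\qquad(*)$$ 1. There exists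 $T>0$ such that $(*)$ has a unique solution $\psi\in C^0([0,T),Q)\cap C^1([0,T),Q^\star)$ on $[0,T)$. 2. There are $T^\star\in(0,\infty]$ and a maximal solution $\psi^{\max}\in C^0([0,T^\star),Q)\cap C^1([0,T^\star),Q^\star)$ of $(*)$ on $[0,T^\star)$: every solution of $(*)$ in $C^0([0,T),Q)\cap C^1([0,T),Q^\star)$ on an interval $[0,T)$, $0<T\le\infty$, satisfies $T\le T^\star$ and coincides with $\psi^{\max}$ on $[0,T)$. Moreover, either $T^\star=\infty$ or $$\lim_{t\to T^\star}\|\psi^{\max}(t)\|_Q=+\infty .$$ -/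

import Mathlib

open MeasureTheory Filter Topology Set
open scoped ContDiff

noncomputable section

namespace DeltaPrimeNLS

/-- The Hilbert space `L²(ℝ)` of complex-valued functions. -/
abbrev L2R : Type := Lp ℂ 2 (volume : Measure ℝ)

/-- `g` is the weak derivative of `f` on `ℝ \ {0}`: `∫ φ' f = - ∫ φ g` for all test functions
`φ ∈ C_c^∞(ℝ \ {0})`. -/
def IsWeakDeriv (f g : L2R) : Prop :=
  ∀ φ : ℝ → ℝ, ContDiff ℝ ∞ φ → HasCompactSupport φ → tsupport φ ⊆ {(0 : ℝ)}ᶜ →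
    ∫ x, deriv φ x • f x = - ∫ x, φ x • g x

theorem integrable_smul_L2R {φ : ℝ → ℝ} (hφ : Continuous φ) (hc : HasCompactSupport φ)
    (f : L2R) : Integrable (fun x => φ x • f x) :=
  ((Lp.memLp f).locallyIntegrable (by norm_num)).integrable_smul_left_of_hasCompactSupport hφ hc

theorem IsWeakDeriv.zero : IsWeakDeriv 0 0 := by
  intro φ _ _ _
  have h : ∀ a : ℝ → ℝ, ∫ x, a x • (0 : L2R) x = 0 := fun a => by
    refine integral_eq_zero_of_ae ?_
    filter_upwards with x
    simp
  rw [h, h, neg_zero]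

theorem IsWeakDeriv.add {f g f' g' : L2R} (h : IsWeakDeriv f g) (h' : IsWeakDeriv f' g') :
    IsWeakDeriv (f + f') (g + g') := by
  intro φ h1 h2 h3
  have key : ∀ a : ℝ → ℝ, Continuous a → HasCompactSupport a → ∀ u v : L2R,
      ∫ x, a x • (u + v) x = (∫ x, a x • u x) + ∫ x, a x • v x := by
    intro a ha hc u v
    rw [← integral_add (integrable_smul_L2R ha hc u) (integrable_smul_L2R ha hc v)]
    refine integral_congr_ae ?_
    filter_upwards [Lp.coeFn_add u v] with x hx
    simp only [hx, Pi.add_apply, smul_add]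
  rw [key _ (h1.continuous_deriv (by simp)) h2.deriv, key _ h1.continuous h2,
    h φ h1 h2 h3, h' φ h1 h2 h3]
  ring

theorem IsWeakDeriv.smul {f g : L2R} (c : ℂ) (h : IsWeakDeriv f g) :
    IsWeakDeriv (c • f) (c • g) := by
  intro φ h1 h2 h3
  have key : ∀ a : ℝ → ℝ, ∀ u : L2R, ∫ x, a x • (c • u) x = c • ∫ x, a x • u x := by
    intro a u
    rw [← integral_smul]
    refine integral_congr_ae ?_
    filter_upwards [Lp.coeFn_smul c u] with x hx
    simp only [hx, Pi.smul_apply]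
    exact smul_comm _ _ _
  rw [key, key, h φ h1 h2 h3, smul_neg]

/-- The weak derivative is unique. -/
theorem IsWeakDeriv.eq_zero {g : L2R} (h : IsWeakDeriv 0 g) : g = 0 := by
  have h0 : ∀ a : ℝ → ℝ, ∫ x, a x • (0 : L2R) x = 0 := fun a => by
    refine integral_eq_zero_of_ae ?_
    filter_upwards with x
    simp
  have key := (isOpen_compl_singleton (x := (0 : ℝ))).ae_eq_zero_of_integral_contDiff_smul_eq_zero
    (μ := volume) (f := g) (((Lp.memLp g).locallyIntegrable (by norm_num)).locallyIntegrableOn _)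
    (fun φ h1 h2 h3 => by
      have := h φ h1 h2 h3
      rw [h0] at this
      exact neg_eq_zero.mp this.symm)
  refine (Lp.eq_zero_iff_ae_eq_zero).mpr ?_
  filter_upwards [key, Measure.ae_ne volume (0 : ℝ)] with x hx hx0
  exact hx hx0

/-- The energy space `Q = H¹(ℝ⁺) ⊕ H¹(ℝ⁻)`. An element is recorded as the pair `(ψ, ψ')` of a
function in `L²(ℝ)` and its weak derivative on `ℝ \ {0}`, also in `L²(ℝ)`; the second component
is determined by the first. The norm is `‖ψ‖_Q² = ‖ψ‖² + ‖ψ'‖²`. -/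
def EnergySpace : Submodule ℂ (WithLp 2 (L2R × L2R)) where
  carrier := {u | IsWeakDeriv u.fst u.snd}
  zero_mem' := IsWeakDeriv.zero
  add_mem' := fun hu hv => IsWeakDeriv.add hu hv
  smul_mem' := fun c _ hu => IsWeakDeriv.smul c hu

/-- The continuous inclusion `Q ⊆ L²(ℝ)`. -/
def toL2 : EnergySpace →L[ℂ] L2R :=
  (WithLp.fstL 2 ℂ L2R L2R).comp EnergySpace.subtypeL

theorem norm_sq_energySpace (u : EnergySpace) :
    ‖u‖ ^ 2 = ‖toL2 u‖ ^ 2 + ‖(u : WithLp 2 (L2R × L2R)).snd‖ ^ 2 :=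
  WithLp.prod_norm_sq_eq_of_L2 (u : WithLp 2 (L2R × L2R))

theorem toL2_injective : Function.Injective toL2 := by
  refine (injective_iff_map_eq_zero toL2).mpr fun u hu => ?_
  have h1 : (u : WithLp 2 (L2R × L2R)).fst = 0 := hu
  have h2 : IsWeakDeriv (u : WithLp 2 (L2R × L2R)).fst (u : WithLp 2 (L2R × L2R)).snd := u.2
  rw [h1] at h2
  have h3 := h2.eq_zero
  have h4 := norm_sq_energySpace u
  rw [hu, h3] at h4
  simpa using h4

/-- The embedding of `Q` into its dual `Q*`, through the scalar product of `L²(ℝ)` (antilinear in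
its first argument): `ψ` acts on `Q` as `φ ↦ (ψ, φ)`. -/
def toDual (u : EnergySpace) : StrongDual ℂ EnergySpace :=
  (innerSL ℂ (toL2 u)).comp toL2

/-- `f(0+) = a`, as an essential limit. -/
def HasRightTrace (f : L2R) (a : ℂ) : Prop :=
  Tendsto (f : ℝ → ℂ) (𝓝[>] (0 : ℝ) ⊓ ae volume) (𝓝 a)

/-- `f(0-) = a`, as an essential limit. -/
def HasLeftTrace (f : L2R) (a : ℂ) : Prop :=
  Tendsto (f : ℝ → ℂ) (𝓝[<] (0 : ℝ) ⊓ ae volume) (𝓝 a)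

theorem trace_zero (l : Filter ℝ) :
    Tendsto ((0 : L2R) : ℝ → ℂ) (l ⊓ ae volume) (𝓝 0) := by
  refine tendsto_const_nhds.congr' (EventuallyEq.symm ?_)
  exact (Lp.coeFn_zero ℂ 2 (volume : Measure ℝ)).filter_mono inf_le_right

theorem trace_add {l : Filter ℝ} {f g : L2R} {a b : ℂ}
    (hf : Tendsto (f : ℝ → ℂ) (l ⊓ ae volume) (𝓝 a))
    (hg : Tendsto (g : ℝ → ℂ) (l ⊓ ae volume) (𝓝 b)) :
    Tendsto ((f + g : L2R) : ℝ → ℂ) (l ⊓ ae volume) (𝓝 (a + b)) := by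
  refine (hf.add hg).congr' (EventuallyEq.symm ?_)
  exact (Lp.coeFn_add f g).filter_mono inf_le_right

theorem trace_smul {l : Filter ℝ} {f : L2R} {a : ℂ} (c : ℂ)
    (hf : Tendsto (f : ℝ → ℂ) (l ⊓ ae volume) (𝓝 a)) :
    Tendsto ((c • f : L2R) : ℝ → ℂ) (l ⊓ ae volume) (𝓝 (c • a)) := by
  refine (hf.const_smul c).congr' (EventuallyEq.symm ?_)
  exact (Lp.coeFn_smul c f).filter_mono inf_le_right

/-- The graph of the `δ'` Hamiltonian `H_γ`: the pairs `(ψ, -ψ'')` with `ψ ∈ H²(ℝ \ {0})`,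
`ψ'(0+) = ψ'(0-) = c` and `ψ(0+) - ψ(0-) = -γ c`. -/
def hamiltonianGraph (γ : ℝ) : Submodule ℂ (L2R × L2R) where
  carrier := {p | ∃ ψ' : L2R, IsWeakDeriv p.1 ψ' ∧ IsWeakDeriv ψ' (-p.2) ∧
    ∃ a b c : ℂ, HasRightTrace p.1 a ∧ HasLeftTrace p.1 b ∧
      HasRightTrace ψ' c ∧ HasLeftTrace ψ' c ∧ a - b = -(γ : ℂ) * c}
  zero_mem' := ⟨0, IsWeakDeriv.zero, by simpa using IsWeakDeriv.zero, 0, 0, 0,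
    trace_zero _, trace_zero _, trace_zero _, trace_zero _, by simp⟩
  add_mem' := by
    rintro p q ⟨p', h1, h2, a, b, c, h3, h4, h5, h6, h7⟩
      ⟨q', k1, k2, a', b', c', k3, k4, k5, k6, k7⟩
    refine ⟨p' + q', h1.add k1, ?_, a + a', b + b', c + c', trace_add h3 k3, trace_add h4 k4,
      trace_add h5 k5, trace_add h6 k6, ?_⟩
    · have := h2.add k2
      rwa [← neg_add] at this
    · linear_combination h7 + k7
  smul_mem' := by
    rintro z p ⟨p', h1, h2, a, b, c, h3, h4, h5, h6, h7⟩
    refine ⟨z • p', h1.smul z, ?_, z • a, z • b, z • c, trace_smul z h3, trace_smul z h4,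
      trace_smul z h5, trace_smul z h6, ?_⟩
    · have := h2.smul z
      rwa [smul_neg] at this
    · simp only [smul_eq_mul]
      linear_combination z * h7

/-- The `δ'` Hamiltonian `H_γ`, an unbounded operator in `L²(ℝ)`, as the partially defined linear
map with the graph above. -/
def hamiltonian (γ : ℝ) : L2R →ₗ.[ℂ] L2R := (hamiltonianGraph γ).toLinearPMap

theorem hamiltonian_graph (γ : ℝ) : (hamiltonian γ).graph = hamiltonianGraph γ := by
  refine Submodule.toLinearPMap_graph_eq _ ?_
  rintro ⟨x, y⟩ ⟨ψ', h1, h2, -⟩ hx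
  simp only at hx h1 h2 ⊢
  subst hx
  have h3 := h1.eq_zero
  subst h3
  simpa using h2.eq_zero

/-- `U` is the strongly continuous one-parameter unitary group `t ↦ e^{-iAt}` generated by `A`:
the orbit of `x` is differentiable at `0` with derivative `-i y` exactly when `x` lies in the
domain of `A` and `A x = y`. Such a group is unique if it exists. -/
structure IsUnitaryGroupOf {E : Type*} [NormedAddCommGroup E] [InnerProductSpace ℂ E]
    [CompleteSpace E] (A : E →ₗ.[ℂ] E) (U : ℝ → E →L[ℂ] E) : Prop where
  mem_unitary : ∀ t, U t ∈ unitary (E →L[ℂ] E)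
  map_zero : U 0 = 1
  map_add : ∀ s t, U (s + t) = U s * U t
  continuous : ∀ x, Continuous fun t => U t x
  generator : ∀ x y, (x, y) ∈ A.graph ↔
    HasDerivAt (fun t : ℝ => U t x) (-(Complex.I • y)) 0

/-- The propagator `t ↦ e^{-i H_γ t}`: the unitary group generated by `H_γ`. -/
def propagator (γ : ℝ) : ℝ → L2R →L[ℂ] L2R :=
  Classical.epsilon fun U => IsUnitaryGroupOf (hamiltonian γ) U

/-- The pointwise nonlinearity `|f|^{2μ} f`. -/
def powFun (μ : ℝ) (f : ℝ → ℂ) (x : ℝ) : ℂ := ((‖f x‖ ^ (2 * μ) : ℝ) : ℂ) * f x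

open Classical in
/-- `|f|^{2μ} f` as an element of `L²(ℝ)`; only used where it is square integrable. -/
def nonlinearity (μ : ℝ) (f : L2R) : L2R :=
  if h : MemLp (powFun μ f) 2 (volume : Measure ℝ) then h.toLp else 0

/-- The interval `[0, T)`, where `T = ∞` is allowed. -/
def timeInterval (T : EReal) : Set ℝ := {t | 0 ≤ t ∧ (t : EReal) < T}

/-- `ψ` belongs to `C⁰([0,T), Q) ∩ C¹([0,T), Q*)` and solves
`ψ(t) = e^{-i H_γ t} ψ₀ + i λ ∫₀ᵗ e^{-i H_γ (t-s)} |ψ(s)|^{2μ} ψ(s) ds` on `[0,T)`. The values of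
`ψ` outside of `[0,T)` are irrelevant. -/
structure IsSolution (γ lam μ : ℝ) (ψ₀ : EnergySpace) (T : EReal) (ψ : ℝ → EnergySpace) :
    Prop where
  continuousOn : ContinuousOn ψ (timeInterval T)
  contDiffOn : ContDiffOn ℝ 1 (fun t => toDual (ψ t)) (timeInterval T)
  memLp : ∀ t ∈ timeInterval T, MemLp (powFun μ (toL2 (ψ t))) 2 (volume : Measure ℝ)
  integrable : ∀ t ∈ timeInterval T, IntervalIntegrable
    (fun s => propagator γ (t - s) (nonlinearity μ (toL2 (ψ s)))) volume 0 t
  duhamel : ∀ t ∈ timeInterval T, toL2 (ψ t) = propagator γ t (toL2 ψ₀) +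
    (Complex.I * (lam : ℂ)) •
      ∫ s in (0 : ℝ)..t, propagator γ (t - s) (nonlinearity μ (toL2 (ψ s)))

end DeltaPrimeNLS

end

noncomputable section

namespace DeltaPrimeNLS

/-! The Hamiltonian is the operator of the quadratic form `‖ψ'‖² - γ⁻¹ |ψ(0+) - ψ(0-)|²` on `Q`. A
weighted trace inequality makes the form coercive after adding a constant `m`, so it is represented
by an invertible operator on `Q`. Hence `K = (H_γ + m)⁻¹` is bounded, self-adjoint and of dense
range on `L²`, and `(x, y)` lies in the graph of `H_γ` iff `x = K (y + m x)`
(`mem_hamiltonian_graph_iff`).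

The unitary group comes from bounded functional calculus only. The function `x e^{-it(1/x - m)}` is
continuous, also at `0`; applied to `K` it gives `K e^{-itH_γ}`, and `e^{-itH_γ}` is the isometric
extension from the range of `K` (`exists_isUnitaryGroupOf`). The group commutes with `K`, so it
conserves the form and is bounded on `Q` uniformly in time (`norm_resolventQ_propagator_le`).

The power nonlinearity maps bounded sets of `Q` to bounded sets of `Q` but is shown to be Lipschitz
on them only in `L²`; for small `μ` one cannot expect a Lipschitz bound in `Q`. The contraction
therefore uses the `L²` distance on a `Q`-bounded set of curves, which is complete because balls of
`Q` are closed in `L²` (`isClosed_image_closedBall`). In the interaction picture the fixed point is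
a primitive of a `Q`-bounded function, hence Lipschitz into `Q` (`exists_isMild`). Uniqueness is
Grönwall's inequality in `L²`.

The existence time depends only on the `Q`-norm of the datum. Gluing all solutions gives the maximal
one; if its norm were below a fixed `R` at times arbitrarily close to a finite `T⋆`, a restart would
pass `T⋆`, so the norm tends to infinity (`exists_maximal`). Differentiability in `Q⋆` is automatic
for mild solutions (`IsMild.contDiffOn`). -/

/-! ### Locally absolutely continuous functions -/

theorem locallyIntegrable_of_forall_intervalIntegrable {E : Type*} [NormedAddCommGroup E]
    {g : ℝ → E} (h : ∀ a b, IntervalIntegrable g volume a b) : LocallyIntegrable g := by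
  refine locallyIntegrable_iff.2 fun k hk => ?_
  obtain ⟨r, hr⟩ := hk.isBounded.subset_closedBall 0
  rw [Real.closedBall_eq_Icc] at hr
  have h1 := (h (0 - r) (0 + r)).1
  rw [← integrableOn_Icc_iff_integrableOn_Ioc] at h1
  exact h1.mono_set hr

theorem _root_.MeasureTheory.LocallyIntegrable.intervalIntegrable' {E : Type*}
    [NormedAddCommGroup E] {g : ℝ → E} (h : LocallyIntegrable g) (a b : ℝ) :
    IntervalIntegrable g volume a b :=
  intervalIntegrable_iff.2 <|
    (h.integrableOn_isCompact isCompact_uIcc).mono_set uIoc_subset_uIcc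

theorem locallyIntegrable_norm {E : Type*} [NormedAddCommGroup E] {g : ℝ → E}
    (h : LocallyIntegrable g) : LocallyIntegrable fun x => ‖g x‖ :=
  locallyIntegrable_of_forall_intervalIntegrable fun a b => (h.intervalIntegrable' a b).norm

/-- `p` is a locally absolutely continuous function with a.e. derivative `g`. -/
structure IsPrimitive (p g : ℝ → ℂ) : Prop where
  locallyIntegrable : LocallyIntegrable g
  sub_eq : ∀ x y, p y - p x = ∫ t in x..y, g t

theorem absolutelyContinuous_of_norm_sub_le {p : ℝ → ℂ} {h : ℝ → ℝ} (hh : LocallyIntegrable h)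
    (hp : ∀ x y, ‖p y - p x‖ ≤ |∫ t in x..y, h t|) (a b : ℝ) :
    AbsolutelyContinuousOnInterval p a b := by
  have h1 := (hh.intervalIntegrable' a b).absolutelyContinuousOnInterval_intervalIntegral
    (c := a) left_mem_uIcc
  unfold AbsolutelyContinuousOnInterval at h1 ⊢
  refine squeeze_zero (fun t => Finset.sum_nonneg fun i _ => dist_nonneg)
    (fun t => Finset.sum_le_sum fun i _ => ?_) h1
  rw [dist_comm, dist_eq_norm, dist_comm, dist_eq_norm, Real.norm_eq_abs,
    intervalIntegral.integral_interval_sub_left (hh.intervalIntegrable' _ _)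
      (hh.intervalIntegrable' _ _)]
  exact hp _ _

/-- Subtracting the primitive of `g` leaves an absolutely continuous function with zero derivative
a.e., which is constant. The product rule and the Lipschitz chain rule below reduce to this
criterion. -/
theorem isPrimitive_of_absolutelyContinuous {p g : ℝ → ℂ} (hg : LocallyIntegrable g)
    (hp : ∀ a b, AbsolutelyContinuousOnInterval p a b) (hd : ∀ᵐ x, HasDerivAt p (g x) x) :
    IsPrimitive p g := by
  refine ⟨hg, fun x y => ?_⟩
  have h1 : AbsolutelyContinuousOnInterval (fun s => p s - ∫ t in x..s, g t) x y := by
    refine (hp x y).sub (absolutelyContinuous_of_norm_sub_le (locallyIntegrable_norm hg) (fun a b => ?_) x y)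
    rw [intervalIntegral.integral_interval_sub_left (hg.intervalIntegrable' _ _)
      (hg.intervalIntegrable' _ _)]
    exact intervalIntegral.norm_integral_le_abs_integral_norm
  obtain ⟨C, hC⟩ := h1.const_of_ae_hasDerivAt_zero (by
    filter_upwards [hd, LocallyIntegrable.ae_hasDerivAt_integral hg] with s hs1 hs2 _
    have := HasDerivAt.fun_sub hs1 (hs2 x)
    rwa [sub_self] at this)
  have h2 := hC x left_mem_uIcc
  have h3 := hC y right_mem_uIcc
  simp only [intervalIntegral.integral_same, sub_zero] at h2
  rw [h2, ← h3]
  ring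

namespace IsPrimitive

variable {p q g h : ℝ → ℂ}

theorem intervalIntegrable (hp : IsPrimitive p g) (a b : ℝ) : IntervalIntegrable g volume a b :=
  hp.locallyIntegrable.intervalIntegrable' a b

theorem continuous (hp : IsPrimitive p g) : Continuous p := by
  have h1 : p = fun x => p 0 + ∫ t in (0 : ℝ)..x, g t := by
    funext x
    rw [← hp.sub_eq]
    ring
  rw [h1]
  exact continuous_const.add (intervalIntegral.continuous_primitive hp.intervalIntegrable 0)

theorem ae_hasDerivAt (hp : IsPrimitive p g) : ∀ᵐ x, HasDerivAt p (g x) x := by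
  filter_upwards [LocallyIntegrable.ae_hasDerivAt_integral hp.locallyIntegrable] with x hx
  have h1 : p = fun x => p 0 + ∫ t in (0 : ℝ)..x, g t := by
    funext x
    rw [← hp.sub_eq]
    ring
  rw [h1]
  exact (hx 0).const_add _

theorem norm_sub_le (hp : IsPrimitive p g) (x y : ℝ) : ‖p y - p x‖ ≤ |∫ t in x..y, ‖g t‖| := by
  rw [hp.sub_eq]
  exact intervalIntegral.norm_integral_le_abs_integral_norm

theorem absolutelyContinuous (hp : IsPrimitive p g) (a b : ℝ) :
    AbsolutelyContinuousOnInterval p a b :=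
  absolutelyContinuous_of_norm_sub_le (locallyIntegrable_norm hp.locallyIntegrable) hp.norm_sub_le a b

theorem mul (hp : IsPrimitive p g) (hq : IsPrimitive q h) :
    IsPrimitive (fun x => p x * q x) (fun x => p x * h x + g x * q x) := by
  refine isPrimitive_of_absolutelyContinuous
    (locallyIntegrable_of_forall_intervalIntegrable fun a b =>
      ((hq.intervalIntegrable a b).continuousOn_mul hp.continuous.continuousOn).add
        ((hp.intervalIntegrable a b).mul_continuousOn hq.continuous.continuousOn))
    (fun a b => (hp.absolutelyContinuous a b).smul (hq.absolutelyContinuous a b)) ?_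
  filter_upwards [hp.ae_hasDerivAt, hq.ae_hasDerivAt] with x h1 h2
  rw [add_comm (p x * h x)]
  exact h1.mul h2

theorem conj (hp : IsPrimitive p g) :
    IsPrimitive (fun x => starRingEnd ℂ (p x)) (fun x => starRingEnd ℂ (g x)) := by
  refine ⟨locallyIntegrable_of_forall_intervalIntegrable fun a b => ?_, fun x y => ?_⟩
  · have := hp.intervalIntegrable a b
    exact ⟨Complex.conjCLE.integrable_comp_iff.2 this.1,
      Complex.conjCLE.integrable_comp_iff.2 this.2⟩
  · rw [← map_sub, hp.sub_eq]
    exact ((Complex.conjCLE : ℂ →L[ℝ] ℂ).intervalIntegral_comp_comm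
      (hp.intervalIntegrable x y)).symm

theorem add_const (hp : IsPrimitive p g) (c : ℂ) : IsPrimitive (fun x => p x + c) g :=
  ⟨hp.locallyIntegrable, fun x y => by rw [← hp.sub_eq]; ring⟩

theorem zero : IsPrimitive 0 0 :=
  ⟨locallyIntegrable_zero, fun x y => by simp⟩

/-- Integration by parts on `(a, ∞)`. -/
theorem integral_Ioi (hp : IsPrimitive p g) {a : ℝ} (hi : IntegrableOn p (Ioi a))
    (hi' : IntegrableOn g (Ioi a)) : ∫ x in Ioi a, g x = - p a := by
  have h1 := intervalIntegral_tendsto_integral_Ioi a hi' tendsto_id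
  have h2 : Tendsto p atTop (𝓝 ((∫ x in Ioi a, g x) + p a)) := by
    refine (h1.add_const (p a)).congr fun x => ?_
    rw [id, ← hp.sub_eq]
    ring
  -- Integrability of `g` gives `p` a limit at infinity, and integrability of `p` forces that limit
  -- to be `0`.
  have h3 : IntegrableAtFilter p atTop := ⟨Ioi a, Ioi_mem_atTop _, hi⟩
  have h4 := h3.eq_zero_of_tendsto (fun s hs => by
    rcases mem_atTop_sets.1 hs with ⟨b, hb⟩
    rw [← top_le_iff, ← Real.volume_Ici (a := b)]
    exact measure_mono hb) h2
  exact eq_neg_of_add_eq_zero_left h4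

/-- Integration by parts on `(-∞, a)`. -/
theorem integral_Iio (hp : IsPrimitive p g) {a : ℝ} (hi : IntegrableOn p (Iio a))
    (hi' : IntegrableOn g (Iio a)) : ∫ x in Iio a, g x = p a := by
  rw [← integrableOn_Iic_iff_integrableOn_Iio] at hi hi'
  have h1 := intervalIntegral_tendsto_integral_Iic a hi' tendsto_id
  rw [integral_Iic_eq_integral_Iio] at h1
  have h2 : Tendsto p atBot (𝓝 (p a - (∫ x in Iio a, g x))) := by
    refine (h1.const_sub (p a)).congr fun x => ?_
    rw [id, ← hp.sub_eq]
    ring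
  have h3 : IntegrableAtFilter p atBot := ⟨Iic a, Iic_mem_atBot _, hi⟩
  have h4 := h3.eq_zero_of_tendsto (fun s hs => by
    rcases mem_atBot_sets.1 hs with ⟨b, hb⟩
    rw [← top_le_iff, ← Real.volume_Iic (a := b)]
    exact measure_mono hb) h2
  exact (sub_eq_zero.1 h4).symm

/-- Composition with a function that is Lipschitz along the range of `p`. -/
theorem comp_lipschitz (hp : IsPrimitive p g) {F : ℂ → ℂ} {L : ℝ} (hL : 0 ≤ L)
    (hF : ∀ x y, ‖F (p y) - F (p x)‖ ≤ L * ‖p y - p x‖) :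
    ∃ k : ℝ → ℂ, StronglyMeasurable k ∧ (∀ᵐ x, ‖k x‖ ≤ L * ‖g x‖) ∧
      IsPrimitive (fun x => F (p x)) k := by
  set f : ℝ → ℂ := fun x => F (p x) with hf
  have hh : LocallyIntegrable fun x => L * ‖g x‖ := (locallyIntegrable_norm hp.locallyIntegrable).smul L
  have hb : ∀ x y, ‖f y - f x‖ ≤ |∫ t in x..y, L * ‖g t‖| := fun x y => by
    rw [intervalIntegral.integral_const_mul, abs_mul, abs_of_nonneg hL]
    exact (hF x y).trans (mul_le_mul_of_nonneg_left (hp.norm_sub_le x y) hL)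
  have hac := absolutelyContinuous_of_norm_sub_le hh hb
  -- No derivative of `F` is used: the real and imaginary parts of `f` are absolutely continuous,
  -- hence differentiable a.e.
  have hre : ∀ a b, AbsolutelyContinuousOnInterval (fun x => (f x).re) a b := fun a b => by
    have := hac a b
    unfold AbsolutelyContinuousOnInterval at this ⊢
    refine squeeze_zero (fun t => Finset.sum_nonneg fun i _ => dist_nonneg)
      (fun t => Finset.sum_le_sum fun i _ => ?_) this
    rw [Real.dist_eq, dist_eq_norm, ← Complex.sub_re]
    exact Complex.abs_re_le_norm _
  have him : ∀ a b, AbsolutelyContinuousOnInterval (fun x => (f x).im) a b := fun a b => by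
    have := hac a b
    unfold AbsolutelyContinuousOnInterval at this ⊢
    refine squeeze_zero (fun t => Finset.sum_nonneg fun i _ => dist_nonneg)
      (fun t => Finset.sum_le_sum fun i _ => ?_) this
    rw [Real.dist_eq, dist_eq_norm, ← Complex.sub_im]
    exact Complex.abs_im_le_norm _
  have hd : ∀ᵐ x, HasDerivAt f (deriv f x) x := by
    have h1 : ∀ᵐ x, ∀ n : ℕ, x ∈ uIcc (-(n : ℝ)) n → DifferentiableAt ℝ (fun x => (f x).re) x :=
      ae_all_iff.2 fun n => (hre (-n) n).ae_differentiableAt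
    have h2 : ∀ᵐ x, ∀ n : ℕ, x ∈ uIcc (-(n : ℝ)) n → DifferentiableAt ℝ (fun x => (f x).im) x :=
      ae_all_iff.2 fun n => (him (-n) n).ae_differentiableAt
    filter_upwards [h1, h2] with x h1 h2
    obtain ⟨n, hn⟩ := exists_nat_ge |x|
    have hx : x ∈ uIcc (-(n : ℝ)) n := by
      rw [uIcc_of_le (by linarith [abs_nonneg x])]
      exact abs_le.1 hn
    have h3 : DifferentiableAt ℝ (fun x => ((f x).re : ℂ) + ((f x).im : ℂ) * Complex.I) x :=
      ((Complex.ofRealCLM.differentiableAt).comp x (h1 n hx)).add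
        (((Complex.ofRealCLM.differentiableAt).comp x (h2 n hx)).mul_const _)
    simp only [Complex.re_add_im] at h3
    exact h3.hasDerivAt
  -- Difference quotients of `f` are dominated by those of the primitive of `L * ‖g‖`, which
  -- converge to `L * ‖g x‖` a.e.
  have hbd : ∀ᵐ x, ‖deriv f x‖ ≤ L * ‖g x‖ := by
    filter_upwards [hd, LocallyIntegrable.ae_hasDerivAt_integral hh] with x h1 h2
    have h3 := (hasDerivAt_iff_tendsto_slope.1 h1).norm
    have h4 := (hasDerivAt_iff_tendsto_slope.1 (h2 x)).norm
    have h5 := le_of_tendsto_of_tendsto h3 h4 (by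
      filter_upwards with y
      simp only [slope_def_module, norm_smul, intervalIntegral.integral_same, sub_zero]
      exact mul_le_mul_of_nonneg_left (hb x y) (norm_nonneg _))
    rwa [Real.norm_of_nonneg (mul_nonneg hL (norm_nonneg _))] at h5
  refine ⟨deriv f, (measurable_deriv f).stronglyMeasurable, hbd,
    isPrimitive_of_absolutelyContinuous ?_ hac hd⟩
  refine hh.mono (measurable_deriv f).aestronglyMeasurable ?_
  filter_upwards [hbd] with x hx
  rwa [Real.norm_of_nonneg (mul_nonneg hL (norm_nonneg _))]

end IsPrimitive

/-! ### Weak derivatives on the punctured line and their absolutely continuous representatives -/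

theorem isPrimitive_integral {g : ℝ → ℂ} (hg : LocallyIntegrable g) :
    IsPrimitive (fun x => ∫ t in (0 : ℝ)..x, g t) g :=
  ⟨hg, fun _ _ => intervalIntegral.integral_interval_sub_left (hg.intervalIntegrable' _ _)
    (hg.intervalIntegrable' _ _)⟩

theorem isPrimitive_of_contDiff {φ : ℝ → ℝ} (hφ : ContDiff ℝ ∞ φ) :
    IsPrimitive (fun x => (φ x : ℂ)) (fun x => ((deriv φ x : ℝ) : ℂ)) := by
  have hc : Continuous (deriv φ) := hφ.continuous_deriv (by simp)
  have hc' : Continuous fun x => ((deriv φ x : ℝ) : ℂ) := Complex.continuous_ofReal.comp hc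
  refine ⟨hc'.locallyIntegrable, fun x y => ?_⟩
  refine (intervalIntegral.integral_eq_sub_of_hasDerivAt (f := fun x => (φ x : ℂ)) (fun t _ => ?_)
    (hc'.intervalIntegrable _ _)).symm
  exact (hφ.differentiable (by simp) t).hasDerivAt.ofReal_comp

/-- The lemma of du Bois-Reymond on an open interval. -/
theorem ae_eq_const_of_integral_deriv_smul_eq_zero {U : Set ℝ} (hU : IsOpen U) (hc : U.OrdConnected)
    (hne : U.Nonempty) {f : ℝ → ℂ} (hf : LocallyIntegrable f)
    (h : ∀ φ : ℝ → ℝ, ContDiff ℝ ∞ φ → HasCompactSupport φ → tsupport φ ⊆ U →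
      ∫ x, deriv φ x • f x = 0) :
    ∃ c, ∀ᵐ x, x ∈ U → f x = c := by
  obtain ⟨x₀, hx₀⟩ := hne
  obtain ⟨ε, hε, hball⟩ := Metric.isOpen_iff.1 hU x₀ hx₀
  let b : ContDiffBump x₀ := ⟨ε / 4, ε / 2, by positivity, by linarith⟩
  set ρ : ℝ → ℝ := b.normed volume with hρ
  have hρs : ContDiff ℝ ∞ ρ := b.contDiff_normed
  have hρc : HasCompactSupport ρ := b.hasCompactSupport_normed
  have hρU : tsupport ρ ⊆ U := by
    rw [hρ, b.tsupport_normed_eq]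
    refine (Metric.closedBall_subset_ball ?_).trans hball
    change ε / 2 < ε
    linarith
  have hρ1 : ∫ x, ρ x = 1 := b.integral_normed
  refine ⟨∫ x, ρ x • f x, ?_⟩
  have key := hU.ae_eq_zero_of_integral_contDiff_smul_eq_zero (μ := volume)
    (f := fun x => f x - ∫ x, ρ x • f x)
    ((hf.sub (locallyIntegrable_const _)).locallyIntegrableOn _) ?_
  · filter_upwards [key] with x hx hxU
    exact sub_eq_zero.1 (hx hxU)
  intro ψ hψ hψc hψU
  set K := tsupport ψ ∪ tsupport ρ with hK
  have hKc : IsCompact K := hψc.isCompact.union hρc.isCompact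
  have hKne : K.Nonempty := by
    refine Nonempty.inr ?_
    rw [hρ, b.tsupport_normed_eq]
    exact ⟨x₀, Metric.mem_closedBall_self b.rOut_pos.le⟩
  have hIcc : Icc (sInf K) (sSup K) ⊆ U :=
    hc.out (union_subset hψU hρU (hKc.sInf_mem hKne)) (union_subset hψU hρU (hKc.sSup_mem hKne))
  have hKI : K ⊆ Icc (sInf K) (sSup K) := fun x hx =>
    ⟨csInf_le hKc.bddBelow hx, le_csSup hKc.bddAbove hx⟩
  -- As `ρ` has integral `1`, `η` has integral `0`, so its primitive is again a test function,
  -- supported in the convex hull of `K` and hence in `U`. Testing with it shows that `f` minus `∫ ρ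
  -- f` annihilates `ψ`.
  set η : ℝ → ℝ := fun x => ψ x - (∫ y, ψ y) * ρ x with hη
  have hηs : ContDiff ℝ ∞ η := hψ.sub (contDiff_const.mul hρs)
  have hη0 : ∀ x, x ∉ K → η x = 0 := fun x hx => by
    rw [hη]
    simp only
    rw [image_eq_zero_of_notMem_tsupport (fun h => hx (Or.inl h)),
      image_eq_zero_of_notMem_tsupport (fun h => hx (Or.inr h)), mul_zero, sub_zero]
  have hηint : ∫ x, η x = 0 := by
    rw [integral_sub (hψ.continuous.integrable_of_hasCompactSupport hψc)
      ((hρs.continuous.integrable_of_hasCompactSupport hρc).const_mul _), integral_const_mul, hρ1]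
    ring
  -- The base point lies strictly left of `K`, so the half-open interval of integration contains all
  -- of `K` once `x` is beyond `sSup K`.
  set φ : ℝ → ℝ := fun x => ∫ t in (sInf K - 1)..x, η t with hφ
  have hφd : ∀ x, HasDerivAt φ (η x) x := fun x =>
    intervalIntegral.integral_hasDerivAt_right (hηs.continuous.intervalIntegrable _ _)
      (hηs.continuous.stronglyMeasurableAtFilter _ _) hηs.continuous.continuousAt
  have hφ' : deriv φ = η := funext fun x => (hφd x).deriv
  have hφs : ContDiff ℝ ∞ φ := contDiff_infty_iff_deriv.2
    ⟨fun x => (hφd x).differentiableAt, by rwa [hφ']⟩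
  have hsupp : Function.support φ ⊆ Icc (sInf K) (sSup K) := by
    intro x hx
    by_contra hcon
    refine hx ?_
    rw [mem_Icc, not_and_or, not_le, not_le] at hcon
    rcases hcon with hcon | hcon
    · refine intervalIntegral.integral_zero_ae ?_
      filter_upwards with t ht
      refine hη0 t fun htK => ?_
      have h1 := (hKI htK).1
      rcases le_max_iff.1 ht.2 with h2 | h2 <;> linarith
    · have hle := (hKI hKne.some_mem).1.trans (hKI hKne.some_mem).2
      rw [hφ]
      simp only
      rw [intervalIntegral.integral_eq_integral_of_support_subset, hηint]
      intro t ht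
      have h1 : t ∈ K := by
        by_contra h2
        exact ht (hη0 t h2)
      have h2 := hKI h1
      exact ⟨by linarith [h2.1], by linarith [h2.2]⟩
  have hts : tsupport φ ⊆ Icc (sInf K) (sSup K) := closure_minimal hsupp isClosed_Icc
  have h1 := h φ hφs (HasCompactSupport.of_support_subset_isCompact isCompact_Icc hsupp)
    (hts.trans hIcc)
  rw [hφ'] at h1
  have i1 := hf.integrable_smul_left_of_hasCompactSupport hψ.continuous hψc
  have i2 := hf.integrable_smul_left_of_hasCompactSupport hρs.continuous hρc
  have h2 : ∫ x, η x • f x = (∫ x, ψ x • f x) - (∫ y, ψ y) • ∫ x, ρ x • f x := by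
    have i3 : Integrable fun x => (∫ y, ψ y) • ρ x • f x := i2.smul (∫ y, ψ y)
    rw [← integral_smul, ← integral_sub i1 i3]
    refine integral_congr_ae (Eventually.of_forall fun x => ?_)
    simp only [hη, sub_smul, mul_smul]
  simp only [smul_sub]
  rw [integral_sub i1 ((hψ.continuous.integrable_of_hasCompactSupport hψc).smul_const _),
    integral_smul_const, ← h2, h1]

/-- `f` is absolutely continuous on both half-lines, with derivative `g`; the functions `pR`, `pL`
are the absolutely continuous representatives, with derivatives `gR`, `gL`. -/
structure IsPiecewisePrimitive (f g pR gR pL gL : ℝ → ℂ) : Prop where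
  right : IsPrimitive pR gR
  left : IsPrimitive pL gL
  eq_right : ∀ᵐ x, 0 < x → f x = pR x
  deriv_eq_right : ∀ᵐ x, 0 < x → g x = gR x
  eq_left : ∀ᵐ x, x < 0 → f x = pL x
  deriv_eq_left : ∀ᵐ x, x < 0 → g x = gL x

theorem integral_eq_add_of_integrable {f : ℝ → ℂ} (hf : Integrable f) :
    ∫ x, f x = (∫ x in Ioi 0, f x) + ∫ x in Iio 0, f x := by
  rw [← intervalIntegral.integral_Iic_add_Ioi (b := 0) hf.integrableOn hf.integrableOn,
    integral_Iic_eq_integral_Iio, add_comm]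

namespace IsPiecewisePrimitive

variable {f g pR gR pL gL f₁ g₁ pR₁ gR₁ pL₁ gL₁ : ℝ → ℂ}

/-- Green's formula on the two half-lines. -/
theorem integral_mul (h : IsPiecewisePrimitive f g pR gR pL gL)
    (h₁ : IsPiecewisePrimitive f₁ g₁ pR₁ gR₁ pL₁ gL₁) (hi : Integrable fun x => f x * f₁ x)
    (hi' : Integrable fun x => f x * g₁ x + g x * f₁ x) :
    ∫ x, (f x * g₁ x + g x * f₁ x) = - (pR 0 * pR₁ 0) + pL 0 * pL₁ 0 := by
  rw [integral_eq_add_of_integrable hi']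
  have e1 : ∀ᵐ x ∂volume.restrict (Ioi (0 : ℝ)), f x * f₁ x = pR x * pR₁ x := by
    rw [ae_restrict_iff' measurableSet_Ioi]
    filter_upwards [h.eq_right, h₁.eq_right] with x a b hx
    rw [a hx, b hx]
  have e2 : ∀ᵐ x ∂volume.restrict (Ioi (0 : ℝ)),
      f x * g₁ x + g x * f₁ x = pR x * gR₁ x + gR x * pR₁ x := by
    rw [ae_restrict_iff' measurableSet_Ioi]
    filter_upwards [h.eq_right, h₁.eq_right, h.deriv_eq_right, h₁.deriv_eq_right] with x a b c d hx
    rw [a hx, b hx, c hx, d hx]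
  have e3 : ∀ᵐ x ∂volume.restrict (Iio (0 : ℝ)), f x * f₁ x = pL x * pL₁ x := by
    rw [ae_restrict_iff' measurableSet_Iio]
    filter_upwards [h.eq_left, h₁.eq_left] with x a b hx
    rw [a hx, b hx]
  have e4 : ∀ᵐ x ∂volume.restrict (Iio (0 : ℝ)),
      f x * g₁ x + g x * f₁ x = pL x * gL₁ x + gL x * pL₁ x := by
    rw [ae_restrict_iff' measurableSet_Iio]
    filter_upwards [h.eq_left, h₁.eq_left, h.deriv_eq_left, h₁.deriv_eq_left] with x a b c d hx
    rw [a hx, b hx, c hx, d hx]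
  rw [integral_congr_ae e2, integral_congr_ae e4,
    (h.right.mul h₁.right).integral_Ioi (hi.integrableOn.congr_fun_ae e1)
      (hi'.integrableOn.congr_fun_ae e2),
    (h.left.mul h₁.left).integral_Iio (hi.integrableOn.congr_fun_ae e3)
      (hi'.integrableOn.congr_fun_ae e4)]

theorem conj (h : IsPiecewisePrimitive f g pR gR pL gL) :
    IsPiecewisePrimitive (fun x => starRingEnd ℂ (f x)) (fun x => starRingEnd ℂ (g x))
      (fun x => starRingEnd ℂ (pR x)) (fun x => starRingEnd ℂ (gR x))
      (fun x => starRingEnd ℂ (pL x)) (fun x => starRingEnd ℂ (gL x)) where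
  right := h.right.conj
  left := h.left.conj
  eq_right := h.eq_right.mono fun x hx hx0 => by rw [hx hx0]
  deriv_eq_right := h.deriv_eq_right.mono fun x hx hx0 => by rw [hx hx0]
  eq_left := h.eq_left.mono fun x hx hx0 => by rw [hx hx0]
  deriv_eq_left := h.deriv_eq_left.mono fun x hx hx0 => by rw [hx hx0]

theorem tendsto_right (h : IsPiecewisePrimitive f g pR gR pL gL) :
    Tendsto f (𝓝[>] (0 : ℝ) ⊓ ae volume) (𝓝 (pR 0)) := by
  refine ((h.right.continuous.tendsto 0).mono_left
    (inf_le_left.trans nhdsWithin_le_nhds)).congr' ?_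
  have h1 : ∀ᶠ x in 𝓝[>] (0 : ℝ) ⊓ ae volume, 0 < x :=
    (eventually_mem_nhdsWithin (s := Ioi (0 : ℝ))).filter_mono inf_le_left
  have h2 : ∀ᶠ x in 𝓝[>] (0 : ℝ) ⊓ ae volume, 0 < x → f x = pR x :=
    Eventually.filter_mono inf_le_right h.eq_right
  filter_upwards [h1, h2] with x a b
  exact (b a).symm

theorem tendsto_left (h : IsPiecewisePrimitive f g pR gR pL gL) :
    Tendsto f (𝓝[<] (0 : ℝ) ⊓ ae volume) (𝓝 (pL 0)) := by
  refine ((h.left.continuous.tendsto 0).mono_left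
    (inf_le_left.trans nhdsWithin_le_nhds)).congr' ?_
  have h1 : ∀ᶠ x in 𝓝[<] (0 : ℝ) ⊓ ae volume, x < 0 :=
    (eventually_mem_nhdsWithin (s := Iio (0 : ℝ))).filter_mono inf_le_left
  have h2 : ∀ᶠ x in 𝓝[<] (0 : ℝ) ⊓ ae volume, x < 0 → f x = pL x :=
    Eventually.filter_mono inf_le_right h.eq_left
  filter_upwards [h1, h2] with x a b
  exact (b a).symm

end IsPiecewisePrimitive

theorem isPiecewisePrimitive_of_contDiff {φ : ℝ → ℝ} (hφ : ContDiff ℝ ∞ φ) :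
    IsPiecewisePrimitive (fun x => (φ x : ℂ)) (fun x => ((deriv φ x : ℝ) : ℂ))
      (fun x => (φ x : ℂ)) (fun x => ((deriv φ x : ℝ) : ℂ))
      (fun x => (φ x : ℂ)) (fun x => ((deriv φ x : ℝ) : ℂ)) where
  right := isPrimitive_of_contDiff hφ
  left := isPrimitive_of_contDiff hφ
  eq_right := by simp
  deriv_eq_right := by simp
  eq_left := by simp
  deriv_eq_left := by simp

/-- Green's formula on both half-lines; the jump at the origin is the point mass of the
distributional derivative on the whole line. It disappears for test functions vanishing at `0`, or
when the function has no jump. -/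
theorem IsPiecewisePrimitive.integral_deriv_smul {f g pR gR pL gL : ℝ → ℂ}
    (h : IsPiecewisePrimitive f g pR gR pL gL) (hf : LocallyIntegrable f)
    (hg : LocallyIntegrable g) {φ : ℝ → ℝ} (hφ : ContDiff ℝ ∞ φ) (hc : HasCompactSupport φ) :
    ∫ x, deriv φ x • f x = - (∫ x, φ x • g x) - φ 0 • (pR 0 - pL 0) := by
  have i1 := hf.integrable_smul_left_of_hasCompactSupport (hφ.continuous_deriv (by simp)) hc.deriv
  have i2 := hg.integrable_smul_left_of_hasCompactSupport hφ.continuous hc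
  have i3 := hf.integrable_smul_left_of_hasCompactSupport hφ.continuous hc
  have h1 := (isPiecewisePrimitive_of_contDiff hφ).integral_mul h
    (by simpa only [Complex.real_smul] using i3)
    (by simpa only [Complex.real_smul] using Integrable.fun_add i2 i1)
  rw [integral_add (by simpa only [Complex.real_smul] using i2)
    (by simpa only [Complex.real_smul] using i1)] at h1
  simp only [Complex.real_smul]
  linear_combination h1

theorem IsPiecewisePrimitive.isWeakDeriv {f g : L2R} {pR gR pL gL : ℝ → ℂ}
    (h : IsPiecewisePrimitive f g pR gR pL gL) : IsWeakDeriv f g := by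
  intro φ h1 h2 h3
  rw [h.integral_deriv_smul ((Lp.memLp f).locallyIntegrable (by norm_num))
    ((Lp.memLp g).locallyIntegrable (by norm_num)) h1 h2,
    image_eq_zero_of_notMem_tsupport (fun h => h3 h rfl), zero_smul, sub_zero]

theorem IsPrimitive.isPiecewisePrimitive {p g : ℝ → ℂ} (h : IsPrimitive p g) :
    IsPiecewisePrimitive p g p g p g where
  right := h
  left := h
  eq_right := by simp
  deriv_eq_right := by simp
  eq_left := by simp
  deriv_eq_left := by simp

/-- On `U`, `f` minus the primitive of `g` has zero weak derivative, so du Bois-Reymond makes it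
constant. Cutting `g` off outside `U` also makes the representative constant beyond the origin, so
later bounds hold on the whole line. -/
theorem exists_isPrimitive_of_isWeakDeriv {U : Set ℝ} (hU : IsOpen U) (hc : U.OrdConnected)
    (hne : U.Nonempty) (h0 : (0 : ℝ) ∉ U) {f g : L2R} (h : IsWeakDeriv f g) :
    ∃ p, IsPrimitive p (U.indicator g) ∧ ∀ᵐ x, x ∈ U → f x = p x := by
  have hf : LocallyIntegrable f := (Lp.memLp f).locallyIntegrable (by norm_num)
  have hg : LocallyIntegrable (U.indicator g) :=
    ((Lp.memLp g).locallyIntegrable (by norm_num)).indicator hU.measurableSet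
  have hp := isPrimitive_integral hg
  obtain ⟨c, hc⟩ := ae_eq_const_of_integral_deriv_smul_eq_zero hU hc hne
    (hf.sub hp.continuous.locallyIntegrable) (fun φ h1 h2 h3 => by
      have h4 := hp.isPiecewisePrimitive.integral_deriv_smul hp.continuous.locallyIntegrable hg h1 h2
      rw [sub_self, smul_zero, sub_zero] at h4
      have h5 := h φ h1 h2 (h3.trans fun x hx => by rintro rfl; exact h0 hx)
      have h6 : ∫ x, φ x • U.indicator g x = ∫ x, φ x • g x := by
        refine integral_congr_ae (Eventually.of_forall fun x => ?_)
        by_cases hx : x ∈ U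
        · simp [hx]
        · simp [hx, image_eq_zero_of_notMem_tsupport fun h => hx (h3 h)]
      have c1 := h1.continuous_deriv (by simp)
      simp only [Pi.sub_apply, smul_sub]
      rw [integral_sub (hf.integrable_smul_left_of_hasCompactSupport c1 h2.deriv)
        (hp.continuous.locallyIntegrable.integrable_smul_left_of_hasCompactSupport c1 h2.deriv),
        h4, h5, h6, sub_self])
  refine ⟨_, hp.add_const c, ?_⟩
  filter_upwards [hc] with x hx hxU
  rw [← hx hxU]
  simp

theorem IsWeakDeriv.exists_isPiecewisePrimitive {f g : L2R} (h : IsWeakDeriv f g) :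
    ∃ pR pL, IsPiecewisePrimitive f g pR ((Ioi 0).indicator g) pL ((Iio 0).indicator g) := by
  obtain ⟨pR, h1, h2⟩ := exists_isPrimitive_of_isWeakDeriv isOpen_Ioi ordConnected_Ioi
    nonempty_Ioi self_notMem_Ioi h
  obtain ⟨pL, h3, h4⟩ := exists_isPrimitive_of_isWeakDeriv isOpen_Iio ordConnected_Iio
    nonempty_Iio self_notMem_Iio h
  exact ⟨pR, pL, h1, h3, h2, Eventually.of_forall fun x hx => by
    simp [indicator_of_mem (mem_Ioi.2 hx)], h4, Eventually.of_forall fun x hx => by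
    simp [indicator_of_mem (mem_Iio.2 hx)]⟩

/-! ### One-dimensional Sobolev bounds -/

theorem integral_norm_sq_L2R (f : L2R) : ∫ x, ‖f x‖ ^ 2 = ‖f‖ ^ 2 := by
  have h1 : inner ℂ f f = ∫ x, inner ℂ (f x) (f x) := L2.inner_def f f
  rw [inner_self_eq_norm_sq_to_K] at h1
  have h2 : (((‖f‖ ^ 2 : ℝ)) : ℂ) = ((∫ x, ‖f x‖ ^ 2 : ℝ) : ℂ) := by
    rw [← integral_complex_ofReal]
    push_cast
    refine h1.trans (integral_congr_ae (Eventually.of_forall fun x => ?_))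
    simp only [inner_self_eq_norm_sq_to_K]
    rfl
  exact_mod_cast h2.symm

theorem integrable_norm_sq_L2R (f : L2R) : Integrable fun x => ‖f x‖ ^ 2 :=
  (Lp.memLp f).integrable_norm_pow (by norm_num)

/-- The pointwise bound behind the one-dimensional Sobolev inequality. -/
theorem norm_sq_le_of_integral_eq {p g : ℝ → ℂ} {F G : L2R} {s : Set ℝ} (hs : MeasurableSet s)
    {a : ℝ} (hF : ∀ᵐ x, x ∈ s → F x = p x) (hG : ∀ᵐ x, x ∈ s → G x = g x)
    (h : IntegrableOn (fun x => p x * starRingEnd ℂ (p x)) s →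
      IntegrableOn (fun x => p x * starRingEnd ℂ (g x) + g x * starRingEnd ℂ (p x)) s →
      ‖∫ x in s, (p x * starRingEnd ℂ (g x) + g x * starRingEnd ℂ (p x))‖ = ‖p a‖ ^ 2)
    {k : ℝ} (hk : 0 < k) : ‖p a‖ ^ 2 ≤ k * ‖F‖ ^ 2 + ‖G‖ ^ 2 / k := by
  have e1 : ∀ᵐ x ∂volume.restrict s,
      F x * starRingEnd ℂ (F x) = p x * starRingEnd ℂ (p x) := by
    rw [ae_restrict_iff' hs]
    filter_upwards [hF] with x a hx
    rw [a hx]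
  have e2 : ∀ᵐ x ∂volume.restrict s,
      F x * starRingEnd ℂ (G x) + G x * starRingEnd ℂ (F x) =
        p x * starRingEnd ℂ (g x) + g x * starRingEnd ℂ (p x) := by
    rw [ae_restrict_iff' hs]
    filter_upwards [hF, hG] with x a b hx
    rw [a hx, b hx]
  have hm : ∀ u : L2R, MemLp (fun x => starRingEnd ℂ (u x)) 2 volume := fun u => (Lp.memLp u).star
  have i1 : Integrable fun x => F x * starRingEnd ℂ (F x) := (Lp.memLp F).integrable_mul (hm F)
  have i2 : Integrable fun x => F x * starRingEnd ℂ (G x) + G x * starRingEnd ℂ (F x) :=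
    ((Lp.memLp F).integrable_mul (hm G)).add ((Lp.memLp G).integrable_mul (hm F))
  rw [← h (i1.integrableOn.congr_fun_ae e1) (i2.integrableOn.congr_fun_ae e2),
    ← integral_congr_ae e2]
  have i3 : Integrable fun x => k * ‖F x‖ ^ 2 + ‖G x‖ ^ 2 / k :=
    ((integrable_norm_sq_L2R F).const_mul k).add ((integrable_norm_sq_L2R G).div_const k)
  calc _ ≤ ∫ x in s, (k * ‖F x‖ ^ 2 + ‖G x‖ ^ 2 / k) := by
        refine norm_integral_le_of_norm_le i3.integrableOn (Eventually.of_forall fun x => ?_)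
        refine (norm_add_le _ _).trans ?_
        rw [norm_mul, norm_mul, RCLike.norm_conj, RCLike.norm_conj]
        -- Young's inequality with a free weight `k`; a large `k` makes the contribution of the
        -- derivative small, as coercivity of the form requires.
        have h1 := sq_nonneg (k * ‖F x‖ - ‖G x‖)
        have h2 : k * ‖F x‖ ^ 2 + ‖G x‖ ^ 2 / k - 2 * (‖F x‖ * ‖G x‖) =
            (k * ‖F x‖ - ‖G x‖) ^ 2 / k := by
          field_simp
          ring
        have h3 := div_nonneg h1 hk.le
        rw [← h2] at h3
        linarith
    _ ≤ ∫ x, (k * ‖F x‖ ^ 2 + ‖G x‖ ^ 2 / k) :=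
        setIntegral_le_integral i3 (Eventually.of_forall fun x => by positivity)
    _ = _ := by
        rw [integral_add ((integrable_norm_sq_L2R F).const_mul k)
          ((integrable_norm_sq_L2R G).div_const k), integral_const_mul, integral_div,
          integral_norm_sq_L2R, integral_norm_sq_L2R]

namespace IsPiecewisePrimitive

variable {f g : L2R} {pR gR pL gL : ℝ → ℂ}

theorem norm_sq_right_le (h : IsPiecewisePrimitive f g pR gR pL gL) {a : ℝ} (ha : 0 ≤ a) {k : ℝ}
    (hk : 0 < k) : ‖pR a‖ ^ 2 ≤ k * ‖f‖ ^ 2 + ‖g‖ ^ 2 / k := by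
  refine norm_sq_le_of_integral_eq (s := Ioi a) (g := gR) measurableSet_Ioi
    (h.eq_right.mono fun x hx hxa => hx (ha.trans_lt hxa))
    (h.deriv_eq_right.mono fun x hx hxa => hx (ha.trans_lt hxa)) (fun h1 h2 => ?_) hk
  rw [(h.right.mul h.right.conj).integral_Ioi h1 h2, norm_neg, norm_mul, RCLike.norm_conj, sq]

theorem norm_sq_left_le (h : IsPiecewisePrimitive f g pR gR pL gL) {a : ℝ} (ha : a ≤ 0) {k : ℝ}
    (hk : 0 < k) : ‖pL a‖ ^ 2 ≤ k * ‖f‖ ^ 2 + ‖g‖ ^ 2 / k := by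
  refine norm_sq_le_of_integral_eq (s := Iio a) (g := gL) measurableSet_Iio
    (h.eq_left.mono fun x hx hxa => hx (hxa.trans_le ha))
    (h.deriv_eq_left.mono fun x hx hxa => hx (hxa.trans_le ha)) (fun h1 h2 => ?_) hk
  rw [(h.left.mul h.left.conj).integral_Iio h1 h2, norm_mul, RCLike.norm_conj, sq]

end IsPiecewisePrimitive

/-! ### The energy space -/

instance : Inner ℂ EnergySpace := InnerProductSpace.toInner

instance : Inner ℂ L2R := InnerProductSpace.toInner

/-- A continuous compactly supported real function as an element of `L²(ℝ)`. -/
def ofCompactSupport (φ : ℝ → ℝ) (h : Continuous φ) (hc : HasCompactSupport φ) : L2R :=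
  MemLp.toLp (fun x => (φ x : ℂ)) ((Complex.continuous_ofReal.comp h).memLp_of_hasCompactSupport
    (hc.comp_left Complex.ofReal_zero))

theorem coeFn_ofCompactSupport {φ : ℝ → ℝ} (h : Continuous φ) (hc : HasCompactSupport φ) :
    ofCompactSupport φ h hc =ᵐ[volume] fun x => (φ x : ℂ) := MemLp.coeFn_toLp _

theorem inner_ofCompactSupport {φ : ℝ → ℝ} (h : Continuous φ) (hc : HasCompactSupport φ)
    (f : L2R) : inner ℂ (ofCompactSupport φ h hc) f = ∫ x, φ x • f x := by
  rw [L2.inner_def]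
  refine integral_congr_ae ?_
  filter_upwards [coeFn_ofCompactSupport h hc] with x hx
  rw [hx, RCLike.inner_apply, Complex.real_smul, mul_comm]
  simp

theorem inner_L2R_eq (f g : L2R) : inner ℂ f g = ∫ x, starRingEnd ℂ (f x) * g x := by
  rw [L2.inner_def]
  refine integral_congr_ae (Eventually.of_forall fun x => ?_)
  simp only [RCLike.inner_apply, mul_comm]

/-- Integration against a test function is an `L²` inner product, so each test function imposes a
closed condition. -/
theorem isClosed_energySpace : IsClosed (EnergySpace : Set (WithLp 2 (L2R × L2R))) := by
  have h1 : (EnergySpace : Set (WithLp 2 (L2R × L2R))) = ⋂ (φ : ℝ → ℝ) (h : ContDiff ℝ ∞ φ)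
      (hc : HasCompactSupport φ) (_ : tsupport φ ⊆ {(0 : ℝ)}ᶜ),
      {u | inner ℂ (ofCompactSupport (deriv φ) (h.continuous_deriv (by simp)) hc.deriv) u.fst =
        - inner ℂ (ofCompactSupport φ h.continuous hc) u.snd} := by
    ext u
    simp only [mem_iInter, inner_ofCompactSupport]
    exact Iff.rfl
  rw [h1]
  refine isClosed_iInter fun φ => isClosed_iInter fun h => isClosed_iInter fun hc =>
    isClosed_iInter fun _ => isClosed_eq ?_ ?_
  · exact continuous_const.inner (WithLp.fstL 2 ℂ L2R L2R).continuous
  · exact (continuous_const.inner (WithLp.sndL 2 ℂ L2R L2R).continuous).neg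

instance : CompleteSpace EnergySpace := isClosed_energySpace.completeSpace_coe

/-- The weak derivative on `ℝ \ {0}`, as a bounded operator `Q → L²(ℝ)`. -/
def energyDeriv : EnergySpace →L[ℂ] L2R :=
  (WithLp.sndL 2 ℂ L2R L2R).comp EnergySpace.subtypeL

theorem isWeakDeriv_energyDeriv (u : EnergySpace) : IsWeakDeriv (toL2 u) (energyDeriv u) := u.2

theorem norm_sq_eq_add (u : EnergySpace) : ‖u‖ ^ 2 = ‖toL2 u‖ ^ 2 + ‖energyDeriv u‖ ^ 2 :=
  norm_sq_energySpace u

/-- The element of the energy space with a given weak derivative. -/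
def energyMk (f g : L2R) (h : IsWeakDeriv f g) : EnergySpace := ⟨WithLp.toLp 2 (f, g), h⟩

@[simp] theorem toL2_energyMk {f g : L2R} (h : IsWeakDeriv f g) : toL2 (energyMk f g h) = f := rfl

@[simp] theorem energyDeriv_energyMk {f g : L2R} (h : IsWeakDeriv f g) :
    energyDeriv (energyMk f g h) = g := rfl

theorem norm_toL2_le (u : EnergySpace) : ‖toL2 u‖ ≤ ‖u‖ := by
  have := norm_sq_eq_add u
  nlinarith [norm_nonneg u, norm_nonneg (toL2 u), sq_nonneg ‖energyDeriv u‖]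

/-! ### Traces -/

/-- Each interval `(0, ε)` has positive measure. This makes essential limits, and so traces, unique.
-/
instance neBot_right : (𝓝[>] (0 : ℝ) ⊓ ae volume).NeBot := by
  refine inf_neBot_iff.2 fun {s} hs {t} ht => ?_
  obtain ⟨ε, hε, h⟩ := mem_nhdsGT_iff_exists_Ioo_subset.1 hs
  by_contra hcon
  have h1 : Ioo 0 ε ⊆ tᶜ := fun x hx hxt => hcon ⟨x, h hx, hxt⟩
  have h2 := measure_mono_null h1 (mem_ae_iff.1 ht)
  rw [Real.volume_Ioo, ENNReal.ofReal_eq_zero] at h2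
  simp only [mem_Ioi] at hε
  linarith

instance neBot_left : (𝓝[<] (0 : ℝ) ⊓ ae volume).NeBot := by
  refine inf_neBot_iff.2 fun {s} hs {t} ht => ?_
  obtain ⟨ε, hε, h⟩ := mem_nhdsLT_iff_exists_Ioo_subset.1 hs
  by_contra hcon
  have h1 : Ioo ε 0 ⊆ tᶜ := fun x hx hxt => hcon ⟨x, h hx, hxt⟩
  have h2 := measure_mono_null h1 (mem_ae_iff.1 ht)
  rw [Real.volume_Ioo, ENNReal.ofReal_eq_zero] at h2
  simp only [mem_Iio] at hε
  linarith

theorem exists_rightTrace (u : EnergySpace) : ∃ a, HasRightTrace (toL2 u) a ∧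
    ∀ k : ℝ, 0 < k → ‖a‖ ^ 2 ≤ k * ‖toL2 u‖ ^ 2 + ‖energyDeriv u‖ ^ 2 / k := by
  obtain ⟨pR, pL, h⟩ := (isWeakDeriv_energyDeriv u).exists_isPiecewisePrimitive
  exact ⟨pR 0, h.tendsto_right, fun k hk => h.norm_sq_right_le le_rfl hk⟩

theorem exists_leftTrace (u : EnergySpace) : ∃ a, HasLeftTrace (toL2 u) a ∧
    ∀ k : ℝ, 0 < k → ‖a‖ ^ 2 ≤ k * ‖toL2 u‖ ^ 2 + ‖energyDeriv u‖ ^ 2 / k := by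
  obtain ⟨pR, pL, h⟩ := (isWeakDeriv_energyDeriv u).exists_isPiecewisePrimitive
  exact ⟨pL 0, h.tendsto_left, fun k hk => h.norm_sq_left_le le_rfl hk⟩

/-- The trace at `0+`. -/
def rightTrace : EnergySpace →L[ℂ] ℂ :=
  LinearMap.mkContinuous
    { toFun := fun u => (exists_rightTrace u).choose
      map_add' := fun u v => tendsto_nhds_unique (exists_rightTrace (u + v)).choose_spec.1 <| by
        rw [map_add]
        exact trace_add (exists_rightTrace u).choose_spec.1 (exists_rightTrace v).choose_spec.1
      map_smul' := fun c u => tendsto_nhds_unique (exists_rightTrace (c • u)).choose_spec.1 <| by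
        rw [map_smul]
        exact trace_smul c (exists_rightTrace u).choose_spec.1 } 1 fun u => by
    have h1 := (exists_rightTrace u).choose_spec.2 1 one_pos
    have h2 := norm_sq_eq_add u
    simp only [LinearMap.coe_mk, AddHom.coe_mk]
    rw [one_mul, div_one, ← h2] at h1
    rw [one_mul]
    exact (sq_le_sq₀ (norm_nonneg _) (norm_nonneg _)).1 h1

/-- The trace at `0-`. -/
def leftTrace : EnergySpace →L[ℂ] ℂ :=
  LinearMap.mkContinuous
    { toFun := fun u => (exists_leftTrace u).choose
      map_add' := fun u v => tendsto_nhds_unique (exists_leftTrace (u + v)).choose_spec.1 <| by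
        rw [map_add]
        exact trace_add (exists_leftTrace u).choose_spec.1 (exists_leftTrace v).choose_spec.1
      map_smul' := fun c u => tendsto_nhds_unique (exists_leftTrace (c • u)).choose_spec.1 <| by
        rw [map_smul]
        exact trace_smul c (exists_leftTrace u).choose_spec.1 } 1 fun u => by
    have h1 := (exists_leftTrace u).choose_spec.2 1 one_pos
    have h2 := norm_sq_eq_add u
    simp only [LinearMap.coe_mk, AddHom.coe_mk]
    rw [one_mul, div_one, ← h2] at h1
    rw [one_mul]
    exact (sq_le_sq₀ (norm_nonneg _) (norm_nonneg _)).1 h1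

theorem hasRightTrace_rightTrace (u : EnergySpace) : HasRightTrace (toL2 u) (rightTrace u) :=
  (exists_rightTrace u).choose_spec.1

theorem hasLeftTrace_leftTrace (u : EnergySpace) : HasLeftTrace (toL2 u) (leftTrace u) :=
  (exists_leftTrace u).choose_spec.1

theorem norm_sq_rightTrace_le (u : EnergySpace) {k : ℝ} (hk : 0 < k) :
    ‖rightTrace u‖ ^ 2 ≤ k * ‖toL2 u‖ ^ 2 + ‖energyDeriv u‖ ^ 2 / k :=
  (exists_rightTrace u).choose_spec.2 k hk

theorem norm_sq_leftTrace_le (u : EnergySpace) {k : ℝ} (hk : 0 < k) :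
    ‖leftTrace u‖ ^ 2 ≤ k * ‖toL2 u‖ ^ 2 + ‖energyDeriv u‖ ^ 2 / k :=
  (exists_leftTrace u).choose_spec.2 k hk

theorem rightTrace_eq {u : EnergySpace} {a : ℂ} (h : HasRightTrace (toL2 u) a) :
    rightTrace u = a := tendsto_nhds_unique (hasRightTrace_rightTrace u) h

theorem leftTrace_eq {u : EnergySpace} {a : ℂ} (h : HasLeftTrace (toL2 u) a) :
    leftTrace u = a := tendsto_nhds_unique (hasLeftTrace_leftTrace u) h

/-- Green's formula in the energy space. -/
theorem inner_energyDeriv_add (u v : EnergySpace) :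
    inner ℂ (toL2 u) (energyDeriv v) + inner ℂ (energyDeriv u) (toL2 v) =
      - (starRingEnd ℂ (rightTrace u) * rightTrace v) +
        starRingEnd ℂ (leftTrace u) * leftTrace v := by
  obtain ⟨pR, pL, h⟩ := (isWeakDeriv_energyDeriv u).exists_isPiecewisePrimitive
  obtain ⟨qR, qL, h'⟩ := (isWeakDeriv_energyDeriv v).exists_isPiecewisePrimitive
  rw [rightTrace_eq h.tendsto_right, rightTrace_eq h'.tendsto_right, leftTrace_eq h.tendsto_left,
    leftTrace_eq h'.tendsto_left]
  have hm : ∀ u : L2R, MemLp (fun x => starRingEnd ℂ (u x)) 2 volume := fun u => (Lp.memLp u).star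
  have hi : ∀ f g : L2R, Integrable fun x => starRingEnd ℂ (f x) * g x := fun f g =>
    (hm f).integrable_mul (Lp.memLp g)
  rw [inner_L2R_eq, inner_L2R_eq, ← integral_add (hi _ _) (hi _ _)]
  exact h.conj.integral_mul h' (hi _ _) ((hi _ _).add (hi _ _))

/-- The energy space contains functions that are smooth on either side of the origin. -/
theorem exists_energySpace_of_contDiff {φ₁ φ₂ : ℝ → ℝ} (h₁ : ContDiff ℝ ∞ φ₁)
    (c₁ : HasCompactSupport φ₁) (h₂ : ContDiff ℝ ∞ φ₂) (c₂ : HasCompactSupport φ₂) :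
    ∃ v : EnergySpace, rightTrace v = φ₁ 0 ∧ leftTrace v = φ₂ 0 := by
  classical
  have hm : ∀ φ : ℝ → ℝ, Continuous φ → HasCompactSupport φ →
      MemLp (fun x => (φ x : ℂ)) 2 (volume : Measure ℝ) := fun φ h hc =>
    (Complex.continuous_ofReal.comp h).memLp_of_hasCompactSupport (hc.comp_left Complex.ofReal_zero)
  have m1 := MemLp.piecewise (s := Ioi (0 : ℝ)) measurableSet_Ioi
    ((hm φ₁ h₁.continuous c₁).restrict _) ((hm φ₂ h₂.continuous c₂).restrict _)
  have m2 := MemLp.piecewise (s := Ioi (0 : ℝ)) measurableSet_Ioi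
    ((hm (deriv φ₁) (h₁.continuous_deriv (by simp)) c₁.deriv).restrict _)
    ((hm (deriv φ₂) (h₂.continuous_deriv (by simp)) c₂.deriv).restrict _)
  have h : IsPiecewisePrimitive m1.toLp m2.toLp (fun x => (φ₁ x : ℂ))
      (fun x => ((deriv φ₁ x : ℝ) : ℂ)) (fun x => (φ₂ x : ℂ))
      (fun x => ((deriv φ₂ x : ℝ) : ℂ)) :=
    { right := isPrimitive_of_contDiff h₁
      left := isPrimitive_of_contDiff h₂
      eq_right := by
        filter_upwards [m1.coeFn_toLp] with x hx h0
        rw [hx, piecewise_eq_of_mem _ _ _ (mem_Ioi.2 h0)]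
      deriv_eq_right := by
        filter_upwards [m2.coeFn_toLp] with x hx h0
        rw [hx, piecewise_eq_of_mem _ _ _ (mem_Ioi.2 h0)]
      eq_left := by
        filter_upwards [m1.coeFn_toLp] with x hx h0
        rw [hx, piecewise_eq_of_notMem _ _ _ (by simpa using h0.le)]
      deriv_eq_left := by
        filter_upwards [m2.coeFn_toLp] with x hx h0
        rw [hx, piecewise_eq_of_notMem _ _ _ (by simpa using h0.le)] }
  exact ⟨energyMk _ _ h.isWeakDeriv, rightTrace_eq h.tendsto_right, leftTrace_eq h.tendsto_left⟩

/-- Supplies test elements with independent one-sided traces, from which the boundary conditions of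
the Hamiltonian are read off. -/
theorem exists_traces_eq (a b : ({0, 1} : Set ℝ)) :
    ∃ v : EnergySpace, rightTrace v = (a : ℝ) ∧ leftTrace v = (b : ℝ) := by
  let η : ContDiffBump (0 : ℝ) := ⟨1, 2, one_pos, one_lt_two⟩
  have hη : ContDiff ℝ ∞ η := η.contDiff
  have hc := η.hasCompactSupport
  have h1 : η 0 = 1 := η.one_of_mem_closedBall (by simpa using η.rIn_pos.le)
  have key : ∀ a : ℝ, a ∈ ({0, 1} : Set ℝ) →
      ∃ φ : ℝ → ℝ, ContDiff ℝ ∞ φ ∧ HasCompactSupport φ ∧ φ 0 = a := by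
    rintro a (rfl | rfl)
    · exact ⟨0, contDiff_const, HasCompactSupport.zero, rfl⟩
    · exact ⟨η, hη, hc, h1⟩
  obtain ⟨φ₁, h₁, c₁, e₁⟩ := key a a.2
  obtain ⟨φ₂, h₂, c₂, e₂⟩ := key b b.2
  rw [← e₁, ← e₂]
  exact exists_energySpace_of_contDiff h₁ c₁ h₂ c₂

/-- Test functions have their classical derivative as weak derivative. -/
theorem isWeakDeriv_ofCompactSupport {φ : ℝ → ℝ} (h : ContDiff ℝ ∞ φ) (hc : HasCompactSupport φ) :
    IsWeakDeriv (ofCompactSupport φ h.continuous hc)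
      (ofCompactSupport (deriv φ) (h.continuous_deriv (by simp)) hc.deriv) := by
  have h1 := coeFn_ofCompactSupport h.continuous hc
  have h2 := coeFn_ofCompactSupport (h.continuous_deriv (by simp)) hc.deriv
  refine IsPiecewisePrimitive.isWeakDeriv (pR := fun x => (φ x : ℂ))
      (gR := fun x => ((deriv φ x : ℝ) : ℂ)) (pL := fun x => (φ x : ℂ))
      (gL := fun x => ((deriv φ x : ℝ) : ℂ)) ⟨isPrimitive_of_contDiff h,
      isPrimitive_of_contDiff h, h1.mono fun x hx _ => hx, h2.mono fun x hx _ => hx,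
      h1.mono fun x hx _ => hx, h2.mono fun x hx _ => hx⟩

/-- Density of `Q` in `L²`: smooth functions supported away from the origin already suffice, the
origin being a null set. -/
theorem eq_zero_of_forall_inner_toL2 {f : L2R} (h : ∀ v, inner ℂ f (toL2 v) = 0) : f = 0 := by
  have key := (isOpen_compl_singleton (x := (0 : ℝ))).ae_eq_zero_of_integral_contDiff_smul_eq_zero
    (μ := volume) (f := f) (((Lp.memLp f).locallyIntegrable (by norm_num)).locallyIntegrableOn _)
    (fun φ h1 h2 h3 => by
      have := h (energyMk _ _ (isWeakDeriv_ofCompactSupport h1 h2))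
      rw [toL2_energyMk, ← inner_conj_symm, map_eq_zero, inner_ofCompactSupport] at this
      exact this)
  refine (Lp.eq_zero_iff_ae_eq_zero).mpr ?_
  filter_upwards [key, Measure.ae_ne volume (0 : ℝ)] with x hx hx0
  exact hx hx0

/-! ### The quadratic form of the Hamiltonian -/

/-- The jump at the origin. -/
def jump : EnergySpace →L[ℂ] ℂ := rightTrace - leftTrace

theorem norm_sq_jump_le (u : EnergySpace) {k : ℝ} (hk : 0 < k) :
    ‖jump u‖ ^ 2 ≤ 4 * (k * ‖toL2 u‖ ^ 2 + ‖energyDeriv u‖ ^ 2 / k) := by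
  have h1 := norm_sq_rightTrace_le u hk
  have h2 := norm_sq_leftTrace_le u hk
  have h3 : ‖jump u‖ ≤ ‖rightTrace u‖ + ‖leftTrace u‖ := norm_sub_le _ _
  have h4 : ‖jump u‖ ^ 2 ≤ (‖rightTrace u‖ + ‖leftTrace u‖) ^ 2 :=
    pow_le_pow_left₀ (norm_nonneg _) h3 2
  nlinarith [sq_nonneg (‖rightTrace u‖ - ‖leftTrace u‖)]

open ContinuousLinearMap in
/-- The bounded operator on `Q` representing the quadratic form of `H_γ + m`. -/
def formOperator (γ m : ℝ) : EnergySpace →L[ℂ] EnergySpace :=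
  (adjoint energyDeriv).comp energyDeriv + (adjoint toL2).comp ((m : ℂ) • toL2) -
    (adjoint jump).comp (((γ⁻¹ : ℝ) : ℂ) • jump)

theorem inner_formOperator (γ m : ℝ) (u v : EnergySpace) :
    inner ℂ (formOperator γ m u) v = inner ℂ (energyDeriv u) (energyDeriv v) +
      m * inner ℂ (toL2 u) (toL2 v) - (γ⁻¹ : ℝ) * (starRingEnd ℂ (jump u) * jump v) := by
  simp only [formOperator, sub_apply, add_apply,
    smul_apply, ContinuousLinearMap.comp_apply, inner_sub_left, inner_add_left,
    inner_smul_left, ContinuousLinearMap.adjoint_inner_left, RCLike.inner_apply, Complex.conj_ofReal, smul_eq_mul,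
    map_mul]
  ring

theorem inner_formOperator_symm (γ m : ℝ) (u v : EnergySpace) :
    inner ℂ (formOperator γ m u) v = inner ℂ u (formOperator γ m v) := by
  rw [← inner_conj_symm u, inner_formOperator, inner_formOperator]
  simp only [map_sub, map_add, map_mul, inner_conj_symm, Complex.conj_ofReal, Complex.conj_conj]
  ring

/-- A shift making the form coercive. -/
def formShift (γ : ℝ) : ℝ := 32 / γ ^ 2 + 1 / 2

theorem formOperator_coercive {γ : ℝ} (hγ : 0 < γ) (u : EnergySpace) :
    ‖u‖ ^ 2 / 2 ≤ (inner ℂ (formOperator γ (formShift γ) u) u).re := by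
  have h1 : inner ℂ (formOperator γ (formShift γ) u) u =
      ((‖energyDeriv u‖ ^ 2 + formShift γ * ‖toL2 u‖ ^ 2 - γ⁻¹ * ‖jump u‖ ^ 2 : ℝ) : ℂ) := by
    rw [inner_formOperator, inner_self_eq_norm_sq_to_K, inner_self_eq_norm_sq_to_K,
      Complex.conj_mul']
    push_cast
    rfl
  rw [h1, Complex.ofReal_re, norm_sq_eq_add, formShift]
  -- With this weight the jump term costs exactly half of `‖u'‖²` plus `32 / γ²` times `‖u‖²` in
  -- `L²`; the remaining `1 / 2` in `formShift` then yields half of the `Q`-norm squared.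
  have h2 := norm_sq_jump_le u (k := 8 / γ) (by positivity)
  have h3 := mul_le_mul_of_nonneg_left h2 (inv_nonneg.2 hγ.le)
  have h4 : γ⁻¹ * (4 * (8 / γ * ‖toL2 u‖ ^ 2 + ‖energyDeriv u‖ ^ 2 / (8 / γ))) =
      32 / γ ^ 2 * ‖toL2 u‖ ^ 2 + ‖energyDeriv u‖ ^ 2 / 2 := by
    field_simp
    ring
  rw [h4] at h3
  linarith

theorem isUnit_formOperator {γ : ℝ} (hγ : 0 < γ) : IsUnit (formOperator γ (formShift γ)) := by
  refine ContinuousLinearMap.isUnit_of_forall_le_norm_inner_map _ (c := 1 / 2) (by norm_num)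
    fun u => ?_
  refine le_trans ?_ ((formOperator_coercive hγ u).trans
    ((le_abs_self _).trans (Complex.abs_re_le_norm _)))
  rw [NNReal.coe_div, NNReal.coe_one, NNReal.coe_ofNat]
  exact le_of_eq (by ring)

/-- The graph of the Hamiltonian in terms of its quadratic form. -/
theorem mem_hamiltonianGraph_iff {γ : ℝ} (hγ : 0 < γ) (m : ℝ) (x y : L2R) :
    (x, y) ∈ hamiltonianGraph γ ↔ ∃ u, toL2 u = x ∧
      ∀ v, inner ℂ (formOperator γ m u) v = inner ℂ (y + (m : ℂ) • x) (toL2 v) := by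
  have hγ' : ((γ : ℝ) : ℂ) ≠ 0 := by exact_mod_cast hγ.ne'
  constructor
  · rintro ⟨x', h1, h2, a, b, c, h3, h4, h5, h6, h7⟩
    refine ⟨energyMk x x' h1, rfl, fun v => ?_⟩
    -- Green's formula for `x'` and `v` leaves the boundary term `-conj c * jump v`; since the jump
    -- of `x` is `-γ c`, the jump term of the form cancels it.
    have e1 := inner_energyDeriv_add (energyMk x' (-y) h2) v
    rw [rightTrace_eq (u := energyMk x' (-y) h2) h5, leftTrace_eq (u := energyMk x' (-y) h2) h6,
      toL2_energyMk, energyDeriv_energyMk, inner_neg_left] at e1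
    have e2 : jump (energyMk x x' h1) = -(γ : ℂ) * c := by
      rw [← h7, jump, sub_apply, rightTrace_eq (u := energyMk x x' h1) h3,
        leftTrace_eq (u := energyMk x x' h1) h4]
    rw [inner_formOperator, e2, toL2_energyMk, energyDeriv_energyMk, inner_add_left,
      inner_smul_left, Complex.conj_ofReal, jump, sub_apply]
    simp only [map_mul, map_neg, Complex.conj_ofReal, Complex.ofReal_inv]
    field_simp
    linear_combination e1
  · rintro ⟨u, rfl, h⟩
    have h' : ∀ v, inner ℂ (energyDeriv u) (energyDeriv v) =
        inner ℂ y (toL2 v) + (γ⁻¹ : ℝ) * (starRingEnd ℂ (jump u) * jump v) := fun v => by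
      have := h v
      rw [inner_formOperator, inner_add_left, inner_smul_left, Complex.conj_ofReal] at this
      linear_combination this
    -- Test functions supported off the origin have no jump, so on them the form identity says that
    -- `-y` is the weak derivative of `u'`.
    have h2 : IsWeakDeriv (energyDeriv u) (-y) := by
      intro φ k1 k2 k3
      have e := h' (energyMk _ _ (isWeakDeriv_ofCompactSupport k1 k2))
      have e0 : jump (energyMk _ _ (isWeakDeriv_ofCompactSupport k1 k2)) = 0 := by
        have t0 : φ =ᶠ[𝓝 0] 0 := notMem_tsupport_iff_eventuallyEq.1 fun h0 => k3 h0 rfl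
        have t1 : ∀ l : Filter ℝ, l ≤ 𝓝 0 → Tendsto (ofCompactSupport φ k1.continuous k2)
            (l ⊓ ae volume) (𝓝 0) := fun l hl => by
          refine tendsto_const_nhds.congr' ?_
          filter_upwards [t0.filter_mono (inf_le_left.trans hl),
            (coeFn_ofCompactSupport k1.continuous k2).filter_mono inf_le_right] with x a b
          rw [b, a]
          simp
        rw [jump, sub_apply,
          rightTrace_eq (u := energyMk _ _ (isWeakDeriv_ofCompactSupport k1 k2))
            (t1 _ nhdsWithin_le_nhds),
          leftTrace_eq (u := energyMk _ _ (isWeakDeriv_ofCompactSupport k1 k2))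
            (t1 _ nhdsWithin_le_nhds), sub_zero]
      rw [e0, mul_zero, mul_zero, add_zero, toL2_energyMk, energyDeriv_energyMk, ← inner_conj_symm,
        ← inner_conj_symm y] at e
      have e1 := (starRingEnd ℂ).injective e
      rw [← inner_ofCompactSupport k1.continuous k2,
        ← inner_ofCompactSupport (k1.continuous_deriv (by simp)) k2.deriv, inner_neg_right, neg_neg]
      exact e1
    set w := energyMk _ _ h2 with hw
    -- Now `u'` is itself in `Q`, and Green's formula reduces the form identity to boundary values.
    -- Traces `(1, 0)` and `(0, 1)` of `v` then show that both traces of `u'` equal `-γ⁻¹ * jump u`: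
    -- these are the natural boundary conditions.
    have hg : ∀ v, - (starRingEnd ℂ (rightTrace w) * rightTrace v) +
        starRingEnd ℂ (leftTrace w) * leftTrace v =
        (γ⁻¹ : ℝ) * (starRingEnd ℂ (jump u) * jump v) := fun v => by
      have e1 := inner_energyDeriv_add w v
      rw [hw, toL2_energyMk, energyDeriv_energyMk, inner_neg_left, h' v, ← hw] at e1
      linear_combination -e1
    have hr : rightTrace w = -(γ⁻¹ : ℝ) * jump u := by
      obtain ⟨v, e1, e2⟩ := exists_traces_eq ⟨1, by simp⟩ ⟨0, by simp⟩
      have e3 := hg v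
      simp only [jump, sub_apply, e1, e2] at e3
      apply (starRingEnd ℂ).injective
      simp only [jump, sub_apply, map_mul, map_neg, Complex.conj_ofReal]
      push_cast at e3 ⊢
      linear_combination -e3
    have hl : leftTrace w = -(γ⁻¹ : ℝ) * jump u := by
      obtain ⟨v, e1, e2⟩ := exists_traces_eq ⟨0, by simp⟩ ⟨1, by simp⟩
      have e3 := hg v
      simp only [jump, sub_apply, e1, e2] at e3
      apply (starRingEnd ℂ).injective
      simp only [jump, sub_apply, map_mul, map_neg, Complex.conj_ofReal]
      push_cast at e3 ⊢
      linear_combination e3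
    refine ⟨energyDeriv u, isWeakDeriv_energyDeriv u, h2, rightTrace u, leftTrace u, rightTrace w,
      hasRightTrace_rightTrace u, hasLeftTrace_leftTrace u, hasRightTrace_rightTrace w, ?_, ?_⟩
    · rw [hr, ← hl]
      exact hasLeftTrace_leftTrace w
    · rw [hr, Complex.ofReal_inv]
      field_simp
      rfl

/-! ### Unitary groups -/

section Dense

variable {E F : Type*} [NormedAddCommGroup E] [NormedSpace ℂ E] [NormedAddCommGroup F]
  [NormedSpace ℂ F]

/-- Strong continuity of a uniformly bounded family may be checked on a dense set. -/
theorem continuous_apply_of_dense {U : ℝ → E →L[ℂ] F} {C : ℝ} (hU : ∀ t x, ‖U t x‖ ≤ C * ‖x‖)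
    {s : Set E} (hs : Dense s) (h : ∀ x ∈ s, Continuous fun t => U t x) (x : E) :
    Continuous fun t => U t x := by
  refine continuous_of_uniform_approx_of_continuous fun u hu => ?_
  obtain ⟨ε, hε, hu⟩ := Metric.mem_uniformity_dist.1 hu
  obtain ⟨y, hy, hxy⟩ := Metric.dense_iff.1 hs x (ε / (|C| + 1)) (by positivity)
  refine ⟨fun t => U t y, h y hxy, fun t => hu ?_⟩
  rw [dist_eq_norm, ← map_sub]
  rw [Metric.mem_ball, dist_comm, dist_eq_norm] at hy
  calc ‖U t (x - y)‖ ≤ C * ‖x - y‖ := hU t _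
    _ ≤ (|C| + 1) * ‖x - y‖ := by gcongr; linarith [le_abs_self C]
    _ < (|C| + 1) * (ε / (|C| + 1)) := by gcongr
    _ = ε := by field_simp

/-- The error from approximating `x` is itself linear in `|t|` with a small constant, so a
first-order remainder may be tested on a dense set. -/
theorem isLittleO_apply_of_dense {A : ℝ → E →L[ℂ] F} {C : ℝ}
    (hA : ∀ t x, ‖A t x‖ ≤ C * |t| * ‖x‖) {s : Set E} (hs : Dense s)
    (h : ∀ x ∈ s, (fun t => A t x) =o[𝓝 0] fun t : ℝ => t) (x : E) :
    (fun t => A t x) =o[𝓝 0] fun t : ℝ => t := by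
  refine Asymptotics.isLittleO_iff.2 fun ε hε => ?_
  obtain ⟨y, hy, hxy⟩ := Metric.dense_iff.1 hs x (ε / 2 / (|C| + 1)) (by positivity)
  rw [Metric.mem_ball, dist_comm, dist_eq_norm] at hy
  filter_upwards [Asymptotics.isLittleO_iff.1 (h y hxy) (half_pos hε)] with t ht
  have h1 : A t x = A t (x - y) + A t y := by rw [← map_add, sub_add_cancel]
  have h2 : ‖A t (x - y)‖ ≤ ε / 2 * ‖t‖ := by
    calc ‖A t (x - y)‖ ≤ C * |t| * ‖x - y‖ := hA t _
      _ ≤ (|C| + 1) * |t| * (ε / 2 / (|C| + 1)) := by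
          gcongr
          linarith [le_abs_self C]
      _ = ε / 2 * ‖t‖ := by
          rw [Real.norm_eq_abs]
          field_simp
  rw [h1]
  refine (norm_add_le _ _).trans ?_
  linarith

end Dense

/-! ### Functional calculus for the group generated by `1/K - m` -/

/-- The multiplier `x e^{-it(1/x - m)}`. -/
def phaseMul (m t x : ℝ) : ℂ := x * Complex.exp (((-(t * (x⁻¹ - m)) : ℝ) : ℂ) * Complex.I)

theorem norm_phaseMul (m t x : ℝ) : ‖phaseMul m t x‖ = |x| := by
  rw [phaseMul, norm_mul, Complex.norm_exp_ofReal_mul_I, mul_one, Complex.norm_real,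
    Real.norm_eq_abs]

/-- The factor `x` damps the oscillation at `0`, where the convention for `0⁻¹` is irrelevant. -/
theorem continuous_phaseMul (m t : ℝ) : Continuous (phaseMul m t) := by
  refine continuous_iff_continuousAt.2 fun x => ?_
  rcases eq_or_ne x 0 with rfl | hx
  · have h0 : phaseMul m t 0 = 0 := by simp [phaseMul]
    rw [ContinuousAt, h0, tendsto_zero_iff_norm_tendsto_zero]
    simp only [norm_phaseMul]
    simpa using (continuous_abs (G := ℝ)).tendsto 0
  · unfold phaseMul
    refine (Complex.continuous_ofReal.continuousAt).mul (ContinuousAt.cexp ?_)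
    refine ContinuousAt.mul (Complex.continuous_ofReal.continuousAt.comp ?_) continuousAt_const
    exact ((continuousAt_const).mul ((continuousAt_inv₀ hx).sub continuousAt_const)).neg

theorem phaseMul_zero (m x : ℝ) : phaseMul m 0 x = x := by simp [phaseMul]

theorem phaseMul_mul (m s t x : ℝ) :
    phaseMul m s x * phaseMul m t x = x * phaseMul m (s + t) x := by
  simp only [phaseMul]
  have : Complex.exp (((-((s + t) * (x⁻¹ - m)) : ℝ) : ℂ) * Complex.I) =
      Complex.exp (((-(s * (x⁻¹ - m)) : ℝ) : ℂ) * Complex.I) *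
        Complex.exp (((-(t * (x⁻¹ - m)) : ℝ) : ℂ) * Complex.I) := by
    rw [← Complex.exp_add]
    congr 1
    push_cast
    ring
  rw [this]
  ring

theorem conj_phaseMul_mul (m t x : ℝ) :
    starRingEnd ℂ (phaseMul m t x) * phaseMul m t x = x * x := by
  rw [Complex.conj_mul', norm_phaseMul, ← Complex.ofReal_pow, sq_abs]
  push_cast
  ring

/-- One factor `x` absorbs the singular frequency: `x (1/x - m) = 1 - m x` is bounded on the
spectrum. -/
theorem norm_phaseMul_sub_le (m s t x : ℝ) :
    ‖phaseMul m t x - phaseMul m s x‖ ≤ |1 - m * x| * |t - s| := by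
  rcases eq_or_ne x 0 with rfl | hx
  · have h0 : ∀ t, phaseMul m t 0 = 0 := fun t => by simp [phaseMul]
    rw [h0, h0, sub_zero, norm_zero]
    positivity
  have h1 : phaseMul m t x - phaseMul m s x = phaseMul m s x *
      (Complex.exp (Complex.I * ((-((t - s) * (x⁻¹ - m)) : ℝ) : ℂ)) - 1) := by
    simp only [phaseMul]
    have : Complex.exp (((-(t * (x⁻¹ - m)) : ℝ) : ℂ) * Complex.I) =
        Complex.exp (((-(s * (x⁻¹ - m)) : ℝ) : ℂ) * Complex.I) *
          Complex.exp (Complex.I * ((-((t - s) * (x⁻¹ - m)) : ℝ) : ℂ)) := by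
      rw [← Complex.exp_add]
      congr 1
      push_cast
      ring
    rw [this]
    ring
  rw [h1, norm_mul, norm_phaseMul]
  refine (mul_le_mul_of_nonneg_left (Real.norm_exp_I_mul_ofReal_sub_one_le) (abs_nonneg x)).trans ?_
  rw [Real.norm_eq_abs, ← abs_mul, ← abs_mul]
  refine le_of_eq ?_
  rw [← abs_neg]
  congr 1
  field_simp

/-- The phases are unbounded as `x → 0`, so the remainder is needed for every `θ`: the power series
handles `|θ| ≤ 1`, the triangle inequality the rest. -/
theorem norm_exp_mul_I_sub_le (θ : ℝ) :
    ‖Complex.exp ((θ : ℂ) * Complex.I) - 1 - θ * Complex.I‖ ≤ 3 * θ ^ 2 := by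
  have hn : ‖(θ : ℂ) * Complex.I‖ = |θ| := by simp
  rcases le_or_gt |θ| 1 with h | h
  · have := Complex.norm_exp_sub_one_sub_id_le (x := (θ : ℂ) * Complex.I) (by rwa [hn])
    rw [hn, sq_abs] at this
    nlinarith [sq_nonneg θ]
  · have h1 : ‖Complex.exp ((θ : ℂ) * Complex.I) - 1 - θ * Complex.I‖ ≤ 1 + 1 + |θ| := by
      refine (norm_sub_le _ _).trans (add_le_add ((norm_sub_le _ _).trans ?_) hn.le)
      rw [Complex.norm_exp_ofReal_mul_I, norm_one]
    rw [← sq_abs]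
    nlinarith

/-- A second factor `x` tames the second-order remainder, since `x² (1/x - m)² = (1 - m x)²`. This
is why orbits are first differentiated on the range of `K²`. -/
theorem norm_phaseMul_taylor_le (m t x : ℝ) :
    ‖phaseMul m t x * x - x * x + (t * Complex.I) * (x - m * (x * x))‖ ≤
      3 * (1 - m * x) ^ 2 * t ^ 2 := by
  rcases eq_or_ne x 0 with rfl | hx
  · simp [phaseMul, sq_nonneg]
  have hx' : (x : ℂ) ≠ 0 := by exact_mod_cast hx
  have h1 : phaseMul m t x * x - x * x + (t * Complex.I) * (x - m * (x * x)) = (x * x) *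
      (Complex.exp (((-(t * (x⁻¹ - m)) : ℝ) : ℂ) * Complex.I) - 1 -
        ((-(t * (x⁻¹ - m)) : ℝ) : ℂ) * Complex.I) := by
    simp only [phaseMul]
    push_cast
    field_simp
    ring
  rw [h1, norm_mul]
  refine (mul_le_mul_of_nonneg_left (norm_exp_mul_I_sub_le _) (norm_nonneg _)).trans
    (le_of_eq ?_)
  rw [norm_mul, Complex.norm_real, ← sq, Real.norm_eq_abs, sq_abs]
  field_simp

section Generation

variable {E : Type*} [NormedAddCommGroup E] [InnerProductSpace ℂ E] [CompleteSpace E]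

/-- The operator `K e^{-it(1/K - m)}`. -/
def phaseOp (K : E →L[ℂ] E) (m t : ℝ) : E →L[ℂ] E := cfc (fun z : ℂ => phaseMul m t z.re) K

variable {K : E →L[ℂ] E}

theorem continuous_phaseMul_re (m t : ℝ) : Continuous fun z : ℂ => phaseMul m t z.re :=
  (continuous_phaseMul m t).comp Complex.continuous_re

theorem phaseOp_zero (hK : IsSelfAdjoint K) (m : ℝ) : phaseOp K m 0 = K := by
  have h1 : (spectrum ℂ K).EqOn (fun z : ℂ => phaseMul m 0 z.re) id := fun z hz => by
    simp only [phaseMul_zero]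
    exact (hK.mem_spectrum_eq_re hz).symm
  rw [phaseOp, cfc_congr h1, cfc_id ℂ K hK.isStarNormal]

theorem phaseOp_mul (hK : IsSelfAdjoint K) (m s t : ℝ) :
    phaseOp K m s * phaseOp K m t = K * phaseOp K m (s + t) := by
  have hn := hK.isStarNormal
  have h1 : (spectrum ℂ K).EqOn (fun z : ℂ => phaseMul m s z.re * phaseMul m t z.re)
      (fun z => id z * phaseMul m (s + t) z.re) := fun z hz => by
    simp only [phaseMul_mul]
    rw [id, ← hK.mem_spectrum_eq_re hz]
  rw [phaseOp, phaseOp, ← cfc_mul _ _ K (continuous_phaseMul_re m s).continuousOn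
    (continuous_phaseMul_re m t).continuousOn, cfc_congr h1,
    cfc_mul _ _ K continuousOn_id (continuous_phaseMul_re m _).continuousOn, cfc_id ℂ K hn, phaseOp]

theorem phaseOp_comm (hK : IsSelfAdjoint K) (m t : ℝ) : phaseOp K m t * K = K * phaseOp K m t := by
  have := phaseOp_mul hK m t 0
  rwa [phaseOp_zero hK, add_zero] at this

/-- The phase has modulus one, so `A = phaseOp K m t` satisfies `A* A = K²`. Hence `K x ↦ A x` is a
well-defined isometry on the range of `K`. -/
theorem norm_phaseOp_apply (hK : IsSelfAdjoint K) (m t : ℝ) (x : E) :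
    ‖phaseOp K m t x‖ = ‖K x‖ := by
  have hn := hK.isStarNormal
  have hc := continuous_phaseMul_re m t
  have h2 : (spectrum ℂ K).EqOn (fun z : ℂ => star (phaseMul m t z.re) * phaseMul m t z.re)
      (fun z => id z * id z) := fun z hz => by
    have := conj_phaseMul_mul m t z.re
    rw [← hK.mem_spectrum_eq_re hz] at this
    exact this
  have h1 : star (phaseOp K m t) * phaseOp K m t = K * K := by
    rw [phaseOp, ← cfc_star, ← cfc_mul _ _ K hc.star.continuousOn hc.continuousOn, cfc_congr h2,
      cfc_mul _ _ K continuousOn_id continuousOn_id, cfc_id ℂ K hn]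
  have h3 : ∀ A : E →L[ℂ] E, ((‖A x‖ ^ 2 : ℝ) : ℂ) = inner ℂ ((star A * A) x) x := fun A => by
    rw [mul_apply_eq_comp, ContinuousLinearMap.star_eq_adjoint,
      ContinuousLinearMap.adjoint_inner_left, inner_self_eq_norm_sq_to_K]
    push_cast
    rfl
  have h4 : ((‖phaseOp K m t x‖ ^ 2 : ℝ) : ℂ) = ((‖K x‖ ^ 2 : ℝ) : ℂ) := by
    rw [h3, h3, h1, hK.star_eq]
  exact (sq_eq_sq₀ (norm_nonneg _) (norm_nonneg _)).1 (by exact_mod_cast h4)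

theorem exists_spectrum_bound (K : E →L[ℂ] E) (m : ℝ) :
    ∃ D : ℝ, 0 ≤ D ∧ ∀ z ∈ spectrum ℂ K, |1 - m * z.re| ≤ D := by
  obtain ⟨D, hD⟩ := (spectrum.isCompact (𝕜 := ℂ) K).exists_bound_of_continuousOn
    (f := fun z : ℂ => 1 - m * z.re) (by fun_prop)
  exact ⟨|D|, abs_nonneg D, fun z hz => (hD z hz).trans (le_abs_self D)⟩

theorem norm_phaseOp_sub_le {m D : ℝ} (hD0 : 0 ≤ D)
    (hD : ∀ z ∈ spectrum ℂ K, |1 - m * z.re| ≤ D) (s t : ℝ) :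
    ‖phaseOp K m t - phaseOp K m s‖ ≤ D * |t - s| := by
  rw [phaseOp, phaseOp, ← cfc_sub _ _ K (continuous_phaseMul_re m t).continuousOn
    (continuous_phaseMul_re m s).continuousOn]
  refine norm_cfc_le (by positivity) fun z hz => (norm_phaseMul_sub_le _ _ _ _).trans ?_
  gcongr
  exact hD z hz

theorem norm_phaseOp_taylor_le (hK : IsSelfAdjoint K) {m D : ℝ}
    (hD : ∀ z ∈ spectrum ℂ K, |1 - m * z.re| ≤ D) (t : ℝ) :
    ‖phaseOp K m t * K - K * K + (t * Complex.I) • (K - (m : ℂ) • (K * K))‖ ≤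
      3 * D ^ 2 * t ^ 2 := by
  have hn := hK.isStarNormal
  have hc := (continuous_phaseMul_re m t).continuousOn (s := spectrum ℂ K)
  have h1 : phaseOp K m t * K - K * K + (t * Complex.I) • (K - (m : ℂ) • (K * K)) =
      cfc (fun z : ℂ => (phaseMul m t z.re * id z - id z * id z) +
        (t * Complex.I) * (id z - (m : ℂ) * (id z * id z))) K := by
    have k0 := cfc_id ℂ K hn
    have c0 : ContinuousOn (id : ℂ → ℂ) (spectrum ℂ K) := continuousOn_id
    have k1 : cfc (fun z : ℂ => id z * id z) K = K * K := by rw [cfc_mul _ _ K c0 c0, k0]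
    have k2 : cfc (fun z : ℂ => phaseMul m t z.re * id z) K = phaseOp K m t * K := by
      rw [cfc_mul _ _ K hc c0, k0, phaseOp]
    have c1 : ContinuousOn (fun z : ℂ => id z * id z) (spectrum ℂ K) := c0.mul c0
    have c2 : ContinuousOn (fun z : ℂ => phaseMul m t z.re * id z) (spectrum ℂ K) := hc.mul c0
    have c3 : ContinuousOn (fun z : ℂ => (m : ℂ) * (id z * id z)) (spectrum ℂ K) :=
      continuousOn_const.mul c1
    have c4 : ContinuousOn (fun z : ℂ => id z - (m : ℂ) * (id z * id z)) (spectrum ℂ K) :=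
      c0.sub c3
    have c5 : ContinuousOn (fun z : ℂ => phaseMul m t z.re * id z - id z * id z) (spectrum ℂ K) :=
      c2.sub c1
    have c6 : ContinuousOn (fun z : ℂ => (t * Complex.I) * (id z - (m : ℂ) * (id z * id z)))
      (spectrum ℂ K) := continuousOn_const.mul c4
    rw [cfc_add K _ _ c5 c6, cfc_sub _ _ K c2 c1, cfc_const_mul _ _ K c4, cfc_sub _ _ K c0 c3,
      cfc_const_mul _ _ K c1, k1, k2, k0]
  rw [h1]
  refine norm_cfc_le (by positivity) fun z hz => ?_
  have h2 := norm_phaseMul_taylor_le m t z.re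
  rw [← hK.mem_spectrum_eq_re hz] at h2
  refine h2.trans ?_
  rw [← sq_abs (1 - m * z.re)]
  have := hD z hz
  gcongr

/-- If `K` is bounded, self-adjoint and has dense range, then `1/K - m` generates a unitary group. -/
theorem exists_isUnitaryGroupOf (hK : IsSelfAdjoint K) (hd : DenseRange K) (m : ℝ)
    (T : E →ₗ.[ℂ] E) (hT : ∀ x y, (x, y) ∈ T.graph ↔ x = K (y + (m : ℂ) • x)) :
    ∃ U, IsUnitaryGroupOf T U := by
  obtain ⟨D, hD0, hD⟩ := exists_spectrum_bound K m
  have hb : ∀ t x, ‖(phaseOp K m t : E →ₗ[ℂ] E) x‖ ≤ 1 * ‖(K : E →ₗ[ℂ] E) x‖ := fun t x => by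
    rw [one_mul]
    exact (norm_phaseOp_apply hK m t x).le
  have hd' : DenseRange (K : E →ₗ[ℂ] E) := hd
  let U : ℝ → E →L[ℂ] E := fun t =>
    LinearMap.extendOfNorm (phaseOp K m t : E →ₗ[ℂ] E) (K : E →ₗ[ℂ] E)
  have hU : ∀ t x, U t (K x) = phaseOp K m t x := fun t x =>
    LinearMap.extendOfNorm_eq hd' ⟨1, hb t⟩ x
  have comm : ∀ t x, phaseOp K m t (K x) = K (phaseOp K m t x) := fun t x =>
    DFunLike.congr_fun (phaseOp_comm hK m t) x
  have hnorm : ∀ t x, ‖U t x‖ = ‖x‖ := fun t x => by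
    have : (fun x => ‖U t x‖) = fun x => ‖x‖ := by
      refine hd.equalizer (U t).continuous.norm continuous_norm (funext fun x => ?_)
      simp only [Function.comp_apply, hU, norm_phaseOp_apply hK]
    exact congrFun this x
  have hUK : ∀ t x, U t (K x) = K (U t x) := fun t x => by
    have : (fun x => U t (K x)) = fun x => K (U t x) := by
      refine hd.equalizer ((U t).continuous.comp K.continuous) (K.continuous.comp (U t).continuous)
        (funext fun x => ?_)
      simp only [Function.comp_apply, hU, comm]
    exact congrFun this x
  -- `phaseOp_mul` carries a surplus factor `K`, so the group law is checked on the range of `K²`.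
  have hdd : DenseRange fun x => K (K x) := hd.comp hd K.continuous
  have hzero : U 0 = 1 := by
    ext x
    have : (fun x => U 0 x) = fun x => x := by
      refine hd.equalizer (U 0).continuous continuous_id (funext fun x => ?_)
      simp only [Function.comp_apply, hU, phaseOp_zero hK]
    exact congrFun this x
  have hadd : ∀ s t, U (s + t) = U s * U t := fun s t => by
    ext x
    have : (fun x => U (s + t) x) = fun x => U s (U t x) := by
      refine hdd.equalizer (U _).continuous ((U s).continuous.comp (U t).continuous)
        (funext fun x => ?_)
      simp only [Function.comp_apply, hU, comm]
      exact (DFunLike.congr_fun (phaseOp_mul hK m s t) x).symm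
    exact congrFun this x
  have hcont : ∀ x, Continuous fun t => U t x := by
    refine continuous_apply_of_dense (C := 1) (fun t x => by rw [hnorm, one_mul]) hd ?_
    rintro _ ⟨x, rfl⟩
    simp only [hU]
    have h1 : LipschitzWith ⟨D, hD0⟩ fun t => phaseOp K m t :=
      LipschitzWith.of_dist_le_mul fun t s => by
        rw [dist_eq_norm, Real.dist_eq]
        exact norm_phaseOp_sub_le hD0 hD s t
    exact h1.continuous.clm_apply continuous_const
  have hderiv : ∀ f, HasDerivAt (fun t : ℝ => U t (K f))
      (-(Complex.I • (f - (m : ℂ) • K f))) 0 := fun f => by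
    rw [hasDerivAt_iff_isLittleO_nhds_zero]
    simp only [hU, zero_add, phaseOp_zero hK]
    -- The first-order remainder of the orbit of `K f`, as an operator applied to `f`: `O(t)` in
    -- operator norm, and `O(t²)` on the range of `K`.
    let A : ℝ → E →L[ℂ] E := fun t => phaseOp K m t - K + (t * Complex.I) • (1 - (m : ℂ) • K)
    have hA : ∀ t x, ‖A t x‖ ≤ (D + ‖1 - (m : ℂ) • K‖) * |t| * ‖x‖ := fun t x => by
      refine (ContinuousLinearMap.le_opNorm _ _).trans ?_
      gcongr
      refine (norm_add_le _ _).trans ?_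
      have h1 := norm_phaseOp_sub_le hD0 hD 0 t
      rw [phaseOp_zero hK, sub_zero] at h1
      rw [norm_smul, norm_mul, Complex.norm_I, mul_one, Complex.norm_real, Real.norm_eq_abs]
      linarith
    refine (isLittleO_apply_of_dense hA hd ?_ f).congr_left fun t => ?_
    · rintro _ ⟨g, rfl⟩
      refine Asymptotics.IsBigO.trans_isLittleO (g := fun t : ℝ => t ^ 2) ?_
        (Asymptotics.isLittleO_pow_id one_lt_two)
      refine Asymptotics.IsBigO.of_bound (3 * D ^ 2 * ‖g‖) (Eventually.of_forall fun t => ?_)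
      have h1 := (phaseOp K m t * K - K * K + (t * Complex.I) • (K - (m : ℂ) • (K * K))).le_opNorm g
      have h2 := norm_phaseOp_taylor_le hK hD t
      rw [Real.norm_eq_abs, abs_of_nonneg (sq_nonneg t)]
      refine h1.trans ?_
      rw [mul_right_comm]
      gcongr
    · simp only [A, add_apply, sub_apply, smul_apply, one_apply_eq_self, smul_neg,
        mul_smul, Complex.coe_smul]
      abel
  refine ⟨U, ?_, hzero, hadd, hcont, fun x y => ?_⟩
  · intro t
    have h1 : star (U t) * U t = 1 :=
      (ContinuousLinearMap.norm_map_iff_adjoint_comp_self (U t)).1 (hnorm t)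
    -- An isometry with a right inverse is unitary.
    have h2 : U t * U (-t) = 1 := by rw [← hadd, add_neg_cancel, hzero]
    refine Unitary.mem_iff.2 ⟨h1, ?_⟩
    calc U t * star (U t) = U t * (star (U t) * (U t * U (-t))) := by rw [h2, mul_one]
      _ = U t * ((star (U t) * U t) * U (-t)) := by rw [mul_assoc]
      _ = 1 := by rw [h1, one_mul, h2]
  · rw [hT]
    constructor
    · intro h
      have h1 := hderiv (y + (m : ℂ) • x)
      rw [← h, add_sub_cancel_right] at h1
      exact h1
    -- If the orbit of `x` has derivative `-i y`, applying `K` gives `-i K y` for the orbit of `K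
    -- x`, whose derivative is already known to be `-i (x - m K x)`. Equating them puts `(x, y)` in
    -- the graph.
    · intro h
      have h1 := hderiv x
      simp only [hUK] at h1
      have h2 := (K.restrictScalars ℝ).hasFDerivAt.comp_hasDerivAt (0 : ℝ) h
      have h3 := h1.unique h2
      simp only [ContinuousLinearMap.coe_restrictScalars', map_neg, map_smul, neg_inj] at h3
      have h4 : x - (m : ℂ) • K x = K y := smul_right_injective E Complex.I_ne_zero h3
      rw [map_add, map_smul, ← h4, sub_add_cancel]

end Generation

/-! ### The propagator -/

theorem denseRange_of_forall_inner {E F : Type*} [NormedAddCommGroup E] [InnerProductSpace ℂ E]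
    [NormedAddCommGroup F] [InnerProductSpace ℂ F] [CompleteSpace F] (T : E →L[ℂ] F)
    (h : ∀ y, (∀ x, inner ℂ (T x) y = 0) → y = 0) : DenseRange T := by
  have h1 : T.rangeᗮ = ⊥ := (Submodule.eq_bot_iff _).2 fun y hy => h y fun x =>
    (Submodule.mem_orthogonal _ _).1 hy _ ⟨x, rfl⟩
  have h2 := Submodule.dense_iff_topologicalClosure_eq_top.2
    ((Submodule.topologicalClosure_eq_top_iff).2 h1)
  exact h2

/-- The operator `(H_γ + m)⁻¹ : L²(ℝ) → Q`. -/
def resolventQ (γ : ℝ) : L2R →L[ℂ] EnergySpace :=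
  (Ring.inverse (formOperator γ (formShift γ))).comp (ContinuousLinearMap.adjoint toL2)

/-- The operator `(H_γ + m)⁻¹` on `L²(ℝ)`. -/
def resolvent (γ : ℝ) : L2R →L[ℂ] L2R := toL2.comp (resolventQ γ)

section Resolvent

variable {γ : ℝ}

theorem formOperator_resolventQ (hγ : 0 < γ) (f : L2R) :
    formOperator γ (formShift γ) (resolventQ γ f) = ContinuousLinearMap.adjoint toL2 f :=
  DFunLike.congr_fun (Ring.mul_inverse_cancel _ (isUnit_formOperator hγ)) _

theorem inner_formOperator_resolventQ (hγ : 0 < γ) (f : L2R) (v : EnergySpace) :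
    inner ℂ (formOperator γ (formShift γ) (resolventQ γ f)) v = inner ℂ f (toL2 v) := by
  rw [formOperator_resolventQ hγ, ContinuousLinearMap.adjoint_inner_left]

theorem formOperator_injective (hγ : 0 < γ) :
    Function.Injective (formOperator γ (formShift γ)) :=
  Function.LeftInverse.injective fun u =>
    DFunLike.congr_fun (Ring.inverse_mul_cancel _ (isUnit_formOperator hγ)) u

theorem formOperator_surjective (hγ : 0 < γ) :
    Function.Surjective (formOperator γ (formShift γ)) :=
  Function.RightInverse.surjective fun u =>
    DFunLike.congr_fun (Ring.mul_inverse_cancel _ (isUnit_formOperator hγ)) u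

/-- The form identity characterizes `x` as the image of `y + m x` under the inverse form operator;
this is the hypothesis of `exists_isUnitaryGroupOf`. -/
theorem mem_hamiltonian_graph_iff (hγ : 0 < γ) (x y : L2R) :
    (x, y) ∈ (hamiltonian γ).graph ↔ x = resolvent γ (y + (formShift γ : ℂ) • x) := by
  rw [hamiltonian_graph, mem_hamiltonianGraph_iff hγ (formShift γ)]
  constructor
  · rintro ⟨u, rfl, h⟩
    have : u = resolventQ γ (y + (formShift γ : ℂ) • toL2 u) :=
      formOperator_injective hγ <| ext_inner_right ℂ fun v => by
        rw [h, inner_formOperator_resolventQ hγ]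
    exact congrArg toL2 this
  · intro h
    exact ⟨_, h.symm, fun v => inner_formOperator_resolventQ hγ _ v⟩

theorem inner_resolventQ_formOperator (hγ : 0 < γ) (u : EnergySpace) (f : L2R) :
    inner ℂ (formOperator γ (formShift γ) u) (resolventQ γ f) = inner ℂ (toL2 u) f := by
  rw [inner_formOperator_symm, ← inner_conj_symm u, inner_formOperator_resolventQ hγ, inner_conj_symm]

theorem inner_resolvent_symm (hγ : 0 < γ) (f g : L2R) :
    inner ℂ (resolvent γ f) g = inner ℂ f (resolvent γ g) := by
  have h1 := inner_resolventQ_formOperator hγ (resolventQ γ f) g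
  rw [inner_formOperator_resolventQ hγ] at h1
  exact h1.symm

theorem isSelfAdjoint_resolvent (hγ : 0 < γ) : IsSelfAdjoint (resolvent γ) :=
  ContinuousLinearMap.isSelfAdjoint_iff_isSymmetric.2 fun f g => inner_resolvent_symm hγ f g

/-- A vector orthogonal to the range is the form operator applied to some `w`, and then `w` is
orthogonal in `L²` to everything. Density in the norm of `Q` allows operators on `Q` to be defined
on resolvent images. -/
theorem denseRange_resolventQ (hγ : 0 < γ) : DenseRange (resolventQ γ) := by
  refine denseRange_of_forall_inner _ fun u hu => ?_
  obtain ⟨w, rfl⟩ := formOperator_surjective hγ u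
  have h1 : toL2 w = 0 := ext_inner_left ℂ fun f => by
    rw [inner_zero_right, ← inner_formOperator_resolventQ hγ, inner_formOperator_symm, hu]
  rw [toL2_injective (h1.trans (map_zero toL2).symm), map_zero]

/-- By symmetry it is enough that the resolvent is injective, which follows from density of `Q` in
`L²`. -/
theorem denseRange_resolvent (hγ : 0 < γ) : DenseRange (resolvent γ) := by
  refine denseRange_of_forall_inner _ fun g hg => ?_
  have h1 : resolvent γ g = 0 := ext_inner_left ℂ fun f => by
    rw [inner_zero_right, ← inner_resolvent_symm hγ, hg]
  have h2 : resolventQ γ g = 0 := toL2_injective (h1.trans (map_zero toL2).symm)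
  exact eq_zero_of_forall_inner_toL2 fun v => by
    rw [← inner_formOperator_resolventQ hγ, h2, map_zero, inner_zero_left]

theorem isUnitaryGroupOf_propagator (hγ : 0 < γ) :
    IsUnitaryGroupOf (hamiltonian γ) (propagator γ) :=
  Classical.epsilon_spec (p := fun U => IsUnitaryGroupOf (hamiltonian γ) U)
    (exists_isUnitaryGroupOf (isSelfAdjoint_resolvent hγ) (denseRange_resolvent hγ) (formShift γ)
      (hamiltonian γ) (mem_hamiltonian_graph_iff hγ))

end Resolvent

namespace IsUnitaryGroupOf

variable {E : Type*} [NormedAddCommGroup E] [InnerProductSpace ℂ E] [CompleteSpace E]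
  {A : E →ₗ.[ℂ] E} {U : ℝ → E →L[ℂ] E}

theorem apply_add (h : IsUnitaryGroupOf A U) (s t : ℝ) (x : E) : U (s + t) x = U s (U t x) := by
  rw [h.map_add]
  rfl

theorem apply_zero (h : IsUnitaryGroupOf A U) (x : E) : U 0 x = x := by
  rw [h.map_zero]
  rfl

theorem norm_apply (h : IsUnitaryGroupOf A U) (t : ℝ) (x : E) : ‖U t x‖ = ‖x‖ :=
  ContinuousLinearMap.norm_map_of_mem_unitary (h.mem_unitary t) x

theorem inner_apply_apply (h : IsUnitaryGroupOf A U) (t : ℝ) (x y : E) :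
    inner ℂ (U t x) (U t y) = inner ℂ x y :=
  ContinuousLinearMap.inner_map_map_of_mem_unitary (h.mem_unitary t) x y

theorem hasDerivAt (h : IsUnitaryGroupOf A U) {x y : E} (hxy : (x, y) ∈ A.graph) (t : ℝ) :
    HasDerivAt (fun t => U t x) (-(Complex.I • U t y)) t := by
  have h1 := (h.generator x y).1 hxy
  have h2 := ((U t).restrictScalars ℝ).hasFDerivAt.comp_hasDerivAt (0 : ℝ) h1
  rw [← sub_self t] at h2
  have h3 := HasDerivAt.comp_sub_const t t h2
  refine (h3.congr_of_eventuallyEq (Eventually.of_forall fun s => ?_)).congr_deriv ?_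
  · simp only [Function.comp_apply, ContinuousLinearMap.coe_restrictScalars']
    rw [← h.apply_add, add_sub_cancel]
  · simp

theorem apply_mem_graph (h : IsUnitaryGroupOf A U) {x y : E} (hxy : (x, y) ∈ A.graph) (t : ℝ) :
    (U t x, U t y) ∈ A.graph := by
  rw [h.generator]
  have h1 := (h.generator x y).1 hxy
  have h2 := ((U t).restrictScalars ℝ).hasFDerivAt.comp_hasDerivAt (0 : ℝ) h1
  refine (h2.congr_of_eventuallyEq (Eventually.of_forall fun s => ?_)).congr_deriv ?_
  · simp only [Function.comp_apply, ContinuousLinearMap.coe_restrictScalars']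
    rw [← h.apply_add, ← h.apply_add, add_comm]
  · simp

end IsUnitaryGroupOf

/-! ### The propagator on the energy space -/

section PropagatorQ

variable {γ : ℝ}

theorem resolvent_mem_graph (hγ : 0 < γ) (f : L2R) :
    (resolvent γ f, f - (formShift γ : ℂ) • resolvent γ f) ∈ (hamiltonian γ).graph := by
  rw [mem_hamiltonian_graph_iff hγ, sub_add_cancel]

theorem propagator_resolvent (hγ : 0 < γ) (t : ℝ) (f : L2R) :
    propagator γ t (resolvent γ f) = resolvent γ (propagator γ t f) := by
  have h1 := (isUnitaryGroupOf_propagator hγ).apply_mem_graph (resolvent_mem_graph hγ f) t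
  rw [mem_hamiltonian_graph_iff hγ, map_sub, map_smul, sub_add_cancel] at h1
  exact h1

/-- The propagator on the energy space. -/
def propagatorQ (γ t : ℝ) : EnergySpace →L[ℂ] EnergySpace :=
  LinearMap.extendOfNorm ((resolventQ γ).comp (propagator γ t) : L2R →ₗ[ℂ] EnergySpace)
    (resolventQ γ : L2R →ₗ[ℂ] EnergySpace)

/-- The form evaluated at `resolventQ γ f` is `⟨f, K f⟩`, conserved because the group is unitary and
commutes with `K`. Coercivity and boundedness of the form turn conservation into a bound uniform in
`t`. -/
theorem norm_resolventQ_propagator_le (hγ : 0 < γ) (t : ℝ) (f : L2R) :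
    ‖resolventQ γ (propagator γ t f)‖ ≤
      √(2 * ‖formOperator γ (formShift γ)‖) * ‖resolventQ γ f‖ := by
  have h1 := formOperator_coercive hγ (resolventQ γ (propagator γ t f))
  have h2 : inner ℂ (formOperator γ (formShift γ) (resolventQ γ (propagator γ t f)))
      (resolventQ γ (propagator γ t f)) =
      inner ℂ (formOperator γ (formShift γ) (resolventQ γ f)) (resolventQ γ f) := by
    rw [inner_formOperator_resolventQ hγ, inner_formOperator_resolventQ hγ]
    change inner ℂ (propagator γ t f) (resolvent γ (propagator γ t f)) = inner ℂ f (resolvent γ f)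
    rw [← propagator_resolvent hγ, (isUnitaryGroupOf_propagator hγ).inner_apply_apply]
  rw [h2] at h1
  have h3 : (inner ℂ (formOperator γ (formShift γ) (resolventQ γ f)) (resolventQ γ f)).re ≤
      ‖formOperator γ (formShift γ)‖ * ‖resolventQ γ f‖ ^ 2 := by
    refine (Complex.re_le_norm _).trans ((norm_inner_le_norm _ _).trans ?_)
    rw [sq, ← mul_assoc]
    gcongr
    exact ContinuousLinearMap.le_opNorm _ _
  refine (sq_le_sq₀ (norm_nonneg _) (by positivity)).1 ?_
  rw [mul_pow, Real.sq_sqrt (by positivity)]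
  linarith

theorem propagatorQ_resolventQ (hγ : 0 < γ) (t : ℝ) (f : L2R) :
    propagatorQ γ t (resolventQ γ f) = resolventQ γ (propagator γ t f) :=
  LinearMap.extendOfNorm_eq (denseRange_resolventQ hγ)
    ⟨_, fun x => norm_resolventQ_propagator_le hγ t x⟩ f

theorem norm_propagatorQ_le (hγ : 0 < γ) (t : ℝ) (u : EnergySpace) :
    ‖propagatorQ γ t u‖ ≤ √(2 * ‖formOperator γ (formShift γ)‖) * ‖u‖ :=
  LinearMap.norm_extendOfNorm_apply_le (denseRange_resolventQ hγ) _
    (fun x => norm_resolventQ_propagator_le hγ t x) u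

theorem toL2_propagatorQ (hγ : 0 < γ) (t : ℝ) (u : EnergySpace) :
    toL2 (propagatorQ γ t u) = propagator γ t (toL2 u) := by
  have : (fun u => toL2 (propagatorQ γ t u)) = fun u => propagator γ t (toL2 u) := by
    refine (denseRange_resolventQ hγ).equalizer (toL2.continuous.comp (propagatorQ γ t).continuous)
      ((propagator γ t).continuous.comp toL2.continuous) (funext fun f => ?_)
    simp only [Function.comp_apply, propagatorQ_resolventQ hγ]
    exact (propagator_resolvent hγ t f).symm
  exact congrFun this u

theorem continuous_propagatorQ (hγ : 0 < γ) (u : EnergySpace) :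
    Continuous fun t => propagatorQ γ t u := by
  refine continuous_apply_of_dense (norm_propagatorQ_le hγ) (denseRange_resolventQ hγ) ?_ u
  rintro _ ⟨f, rfl⟩
  simp only [propagatorQ_resolventQ hγ]
  exact (resolventQ γ).continuous.comp ((isUnitaryGroupOf_propagator hγ).continuous f)

end PropagatorQ

/-! ### Abstract semilinear evolution equations -/

/-- A unitary group `U` on `E` that leaves the densely embedded space `V` invariant, and a
nonlinearity `N` that is bounded on bounded sets of `V` and, on these, Lipschitz in `E`. -/
structure SemilinearFlow (E V : Type*) [NormedAddCommGroup E] [InnerProductSpace ℂ E]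
    [NormedAddCommGroup V] [InnerProductSpace ℂ V] where
  embed : V →L[ℂ] E
  embed_injective : Function.Injective embed
  U : ℝ → E →L[ℂ] E
  U_zero : ∀ x, U 0 x = x
  U_add : ∀ s t x, U (s + t) x = U s (U t x)
  norm_U : ∀ t x, ‖U t x‖ = ‖x‖
  continuous_U : ∀ x, Continuous fun t => U t x
  UV : ℝ → V →L[ℂ] V
  bound : ℝ
  bound_nonneg : 0 ≤ bound
  norm_UV_le : ∀ t v, ‖UV t v‖ ≤ bound * ‖v‖
  embed_UV : ∀ t v, embed (UV t v) = U t (embed v)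
  continuous_UV : ∀ v, Continuous fun t => UV t v
  N : E → E
  exists_mapsTo : ∀ R : ℝ, ∃ M : ℝ, MapsTo N (embed '' Metric.closedBall 0 R)
    (embed '' Metric.closedBall 0 M)
  exists_lipschitz : ∀ R : ℝ, ∃ L, LipschitzOnWith L N (embed '' Metric.closedBall 0 R)

theorem continuous_uncurry_of_bound {E F : Type*} [NormedAddCommGroup E] [NormedSpace ℂ E]
    [NormedAddCommGroup F] [NormedSpace ℂ F] {U : ℝ → E →L[ℂ] F} {C : ℝ}
    (hb : ∀ t x, ‖U t x‖ ≤ C * ‖x‖) (hc : ∀ x, Continuous fun t => U t x) :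
    Continuous fun p : ℝ × E => U p.1 p.2 := by
  refine continuous_iff_continuousAt.2 fun ⟨t, x⟩ => ?_
  rw [ContinuousAt, tendsto_iff_norm_sub_tendsto_zero]
  have h1 : Tendsto (fun p : ℝ × E => C * ‖p.2 - x‖ + ‖U p.1 x - U t x‖) (𝓝 (t, x))
      (𝓝 (C * ‖x - x‖ + ‖U t x - U t x‖)) := by
    refine Continuous.tendsto (f := fun p : ℝ × E => C * ‖p.2 - x‖ + ‖U p.1 x - U t x‖) ?_ (t, x)
    exact ((continuous_snd.sub continuous_const).norm.const_mul C).add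
      (((hc x).comp continuous_fst).sub continuous_const).norm
  rw [sub_self, sub_self, norm_zero, norm_zero, mul_zero, add_zero] at h1
  refine squeeze_zero (fun _ => norm_nonneg _) (fun p => ?_) h1
  have h2 : U p.1 p.2 - U t x = U p.1 (p.2 - x) + (U p.1 x - U t x) := by
    rw [map_sub]
    abel
  rw [h2]
  exact (norm_add_le _ _).trans (add_le_add_left (hb _ _) _)

/-- A continuous function on `[0, b]` extends continuously to the line. -/
theorem exists_continuous_extension {E : Type*} [TopologicalSpace E] {f : ℝ → E} {b : ℝ}
    (hb : 0 ≤ b) (hf : ContinuousOn f (Icc 0 b)) :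
    ∃ g : ℝ → E, Continuous g ∧ ∀ s ∈ Icc 0 b, g s = f s :=
  ⟨IccExtend hb ((Icc 0 b).domRestrict f), hf.domRestrict.Icc_extend', fun s hs => by
    rw [IccExtend_of_mem hb _ hs]
    rfl⟩

theorem Icc_subset_timeInterval {T : EReal} {t : ℝ} (ht : t ∈ timeInterval T) :
    Icc 0 t ⊆ timeInterval T := fun _ hs =>
  ⟨hs.1, (EReal.coe_le_coe_iff.2 hs.2).trans_lt ht.2⟩

theorem timeInterval_mono {S T : EReal} (h : S ≤ T) : timeInterval S ⊆ timeInterval T :=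
  fun _ ht => ⟨ht.1, ht.2.trans_le h⟩

theorem mem_timeInterval_coe {t T : ℝ} : t ∈ timeInterval T ↔ 0 ≤ t ∧ t < T := by
  simp [timeInterval]

/-! ### Images of balls of `V` in `E` -/

section Ball

variable {E V : Type*} [NormedAddCommGroup E] [InnerProductSpace ℂ E]
  [NormedAddCommGroup V] [InnerProductSpace ℂ V]

theorem add_mem_image_closedBall {A : V →L[ℂ] E} {R S : ℝ} {f g : E}
    (hf : f ∈ A '' Metric.closedBall 0 R) (hg : g ∈ A '' Metric.closedBall 0 S) :
    f + g ∈ A '' Metric.closedBall 0 (R + S) := by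
  obtain ⟨u, hu, rfl⟩ := hf
  obtain ⟨v, hv, rfl⟩ := hg
  rw [mem_closedBall_zero_iff] at hu hv
  exact ⟨u + v, mem_closedBall_zero_iff.2 ((norm_add_le _ _).trans (add_le_add hu hv)), map_add _ _ _⟩

theorem image_closedBall_mono {A : V →L[ℂ] E} {R S : ℝ} (h : R ≤ S) :
    A '' Metric.closedBall 0 R ⊆ A '' Metric.closedBall 0 S :=
  image_mono (Metric.closedBall_subset_closedBall h)

variable [CompleteSpace E] [CompleteSpace V]

/-- A dual description of the image of a ball under a bounded operator. -/
theorem mem_image_closedBall_iff {A : V →L[ℂ] E} (hA : Function.Injective A) {R : ℝ} (hR : 0 ≤ R)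
    (f : E) : f ∈ A '' Metric.closedBall 0 R ↔
      ∀ g, ‖inner ℂ f g‖ ≤ R * ‖ContinuousLinearMap.adjoint A g‖ := by
  constructor
  · rintro ⟨u, hu, rfl⟩ g
    rw [← ContinuousLinearMap.adjoint_inner_right]
    refine (norm_inner_le_norm _ _).trans ?_
    gcongr
    simpa using hu
  · intro h
    -- Injectivity of `A` means dense range of its adjoint. The bound makes `A* g ↦ ⟨f, g⟩` a
    -- functional of norm at most `R` on `V`, and its Riesz vector is the preimage of `f`.
    have hd : DenseRange (ContinuousLinearMap.adjoint A) := denseRange_of_forall_inner _ fun u hu =>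
      hA <| by
        rw [map_zero]
        exact ext_inner_left ℂ fun g => by
          rw [← ContinuousLinearMap.adjoint_inner_left, hu, inner_zero_right]
    have hb : ∀ g, ‖(innerSL ℂ f : E →ₗ[ℂ] ℂ) g‖ ≤
        R * ‖(ContinuousLinearMap.adjoint A : E →ₗ[ℂ] V) g‖ := h
    set l := LinearMap.extendOfNorm (innerSL ℂ f : E →ₗ[ℂ] ℂ)
      (ContinuousLinearMap.adjoint A : E →ₗ[ℂ] V) with hl
    have h1 : ∀ g, l (ContinuousLinearMap.adjoint A g) = inner ℂ f g := fun g =>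
      LinearMap.extendOfNorm_eq hd ⟨R, hb⟩ g
    have h2 : ‖l‖ ≤ R := LinearMap.opNorm_extendOfNorm_le hd hR hb
    refine ⟨(InnerProductSpace.toDual ℂ V).symm l, ?_, ext_inner_right ℂ fun g => ?_⟩
    · rw [mem_closedBall_zero_iff, LinearIsometryEquiv.norm_map]
      exact h2
    · rw [← ContinuousLinearMap.adjoint_inner_right, InnerProductSpace.toDual_symm_apply, h1]

/-- The dual description is an intersection of closed conditions on `f`. It makes a `V`-bounded set
of curves complete for the weaker `E`-distance. -/
theorem isClosed_image_closedBall {A : V →L[ℂ] E} (hA : Function.Injective A) {R : ℝ}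
    (hR : 0 ≤ R) : IsClosed (A '' Metric.closedBall 0 R) := by
  have : A '' Metric.closedBall 0 R =
      ⋂ g, {f | ‖inner ℂ f g‖ ≤ R * ‖ContinuousLinearMap.adjoint A g‖} := by
    ext f
    rw [mem_image_closedBall_iff hA hR, mem_iInter]
    rfl
  rw [this]
  exact isClosed_iInter fun g => isClosed_le (continuous_id.inner continuous_const).norm
    continuous_const

/-- The integrand is continuous only in `E`, so the `V`-bound is passed through the integral by the
dual description. -/
theorem integral_mem_image_closedBall {A : V →L[ℂ] E} (hA : Function.Injective A) {R : ℝ}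
    (hR : 0 ≤ R) {F : ℝ → E} (hF : Continuous F) {a b : ℝ}
    (h : ∀ s ∈ uIcc a b, F s ∈ A '' Metric.closedBall 0 R) :
    ∫ s in a..b, F s ∈ A '' Metric.closedBall 0 (R * |b - a|) := by
  rw [mem_image_closedBall_iff hA (by positivity)]
  intro g
  have h1 : inner ℂ g (∫ s in a..b, F s) = ∫ s in a..b, inner ℂ g (F s) :=
    ((innerSL ℂ g).intervalIntegral_comp_comm (hF.intervalIntegrable a b)).symm
  rw [norm_inner_symm, h1]
  refine (intervalIntegral.norm_integral_le_of_norm_le_const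
    (C := R * ‖ContinuousLinearMap.adjoint A g‖) fun s hs => ?_).trans (le_of_eq (by ring))
  rw [norm_inner_symm]
  exact (mem_image_closedBall_iff hA hR _).1 (h s (uIoc_subset_uIcc hs)) g

end Ball

/-! ### Mild solutions: uniqueness and concatenation -/

namespace SemilinearFlow

variable {E V : Type*} [NormedAddCommGroup E] [InnerProductSpace ℂ E]
  [NormedAddCommGroup V] [InnerProductSpace ℂ V] (D : SemilinearFlow E V)

/-- Mild solutions, continuous with values in `V`. -/
structure IsMild (v₀ : V) (T : EReal) (ψ : ℝ → V) : Prop where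
  continuousOn : ContinuousOn ψ (timeInterval T)
  duhamel : ∀ t ∈ timeInterval T, D.embed (ψ t) = D.U t (D.embed v₀) +
    ∫ s in (0 : ℝ)..t, D.U (t - s) (D.N (D.embed (ψ s)))

theorem U_neg_U (t : ℝ) (x : E) : D.U (-t) (D.U t x) = x := by
  rw [← D.U_add, neg_add_cancel, D.U_zero]

theorem U_U_neg (t : ℝ) (x : E) : D.U t (D.U (-t) x) = x := by
  rw [← D.U_add, add_neg_cancel, D.U_zero]

theorem continuous_U_uncurry : Continuous fun p : ℝ × E => D.U p.1 p.2 :=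
  continuous_uncurry_of_bound (C := 1) (fun t x => by rw [D.norm_U, one_mul]) D.continuous_U

theorem continuous_UV_uncurry : Continuous fun p : ℝ × V => D.UV p.1 p.2 :=
  continuous_uncurry_of_bound D.norm_UV_le D.continuous_UV

theorem continuous_N_embed : Continuous fun v => D.N (D.embed v) := by
  refine continuous_iff_continuousAt.2 fun v => ?_
  obtain ⟨L, hL⟩ := D.exists_lipschitz (‖v‖ + 1)
  have h1 : ContinuousOn (fun v => D.N (D.embed v)) (Metric.closedBall 0 (‖v‖ + 1)) :=
    hL.continuousOn.comp D.embed.continuous.continuousOn (mapsTo_image _ _)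
  refine h1.continuousAt (Metric.closedBall_mem_nhds_of_mem ?_)
  simp

theorem U_mem_image_closedBall {R : ℝ} (t : ℝ) {x : E}
    (hx : x ∈ D.embed '' Metric.closedBall 0 R) :
    D.U t x ∈ D.embed '' Metric.closedBall 0 (D.bound * R) := by
  obtain ⟨u, hu, rfl⟩ := hx
  rw [mem_closedBall_zero_iff] at hu
  have hC := D.bound_nonneg
  exact ⟨D.UV t u, mem_closedBall_zero_iff.2 ((D.norm_UV_le t u).trans (by gcongr)), D.embed_UV t u⟩

variable {D}

theorem integral_U_sub [CompleteSpace E] (t a b : ℝ) {F : ℝ → E} (hF : IntervalIntegrable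
    (fun s => D.U (-s) (F s)) volume a b) :
    ∫ s in a..b, D.U (t - s) (F s) = D.U t (∫ s in a..b, D.U (-s) (F s)) := by
  rw [← (D.U t).intervalIntegral_comp_comm hF]
  simp only [← D.U_add, sub_eq_add_neg]

namespace IsMild

variable {v₀ : V} {T : EReal} {ψ : ℝ → V}

theorem continuousOn_N (h : D.IsMild v₀ T ψ) :
    ContinuousOn (fun s => D.N (D.embed (ψ s))) (timeInterval T) :=
  D.continuous_N_embed.comp_continuousOn h.continuousOn

theorem continuousOn_U_N (h : D.IsMild v₀ T ψ) :
    ContinuousOn (fun s => D.U (-s) (D.N (D.embed (ψ s)))) (timeInterval T) :=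
  D.continuous_U_uncurry.comp_continuousOn (continuousOn_id.neg.prodMk h.continuousOn_N)

theorem intervalIntegrable (h : D.IsMild v₀ T ψ) {t : ℝ} (ht : t ∈ timeInterval T) :
    IntervalIntegrable (fun s => D.U (-s) (D.N (D.embed (ψ s)))) volume 0 t := by
  refine ContinuousOn.intervalIntegrable (h.continuousOn_U_N.mono ?_)
  rw [uIcc_of_le ht.1]
  exact Icc_subset_timeInterval ht

theorem intervalIntegrable_sub (h : D.IsMild v₀ T ψ) {t : ℝ} (ht : t ∈ timeInterval T) (r : ℝ) :
    IntervalIntegrable (fun s => D.U (r - s) (D.N (D.embed (ψ s)))) volume 0 t := by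
  refine ContinuousOn.intervalIntegrable (ContinuousOn.mono
    (D.continuous_U_uncurry.comp_continuousOn ((continuousOn_const.sub continuousOn_id).prodMk
      h.continuousOn_N)) ?_)
  rw [uIcc_of_le ht.1]
  exact Icc_subset_timeInterval ht

theorem mono (h : D.IsMild v₀ T ψ) {S : EReal} (hS : S ≤ T) : D.IsMild v₀ S ψ :=
  ⟨h.continuousOn.mono (timeInterval_mono hS), fun t ht => h.duhamel t (timeInterval_mono hS ht)⟩

variable [CompleteSpace E]

/-- The equation in the interaction picture. -/
theorem U_neg_embed (h : D.IsMild v₀ T ψ) {t : ℝ} (ht : t ∈ timeInterval T) :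
    D.U (-t) (D.embed (ψ t)) = D.embed v₀ + ∫ s in (0 : ℝ)..t, D.U (-s) (D.N (D.embed (ψ s))) := by
  rw [h.duhamel t ht, integral_U_sub _ _ _ (h.intervalIntegrable ht), map_add, U_neg_U, U_neg_U]

theorem apply_zero (h : D.IsMild v₀ T ψ) (hT : 0 < T) : ψ 0 = v₀ := by
  have := h.U_neg_embed (t := 0) ⟨le_rfl, hT⟩
  rw [neg_zero, D.U_zero, intervalIntegral.integral_same, add_zero] at this
  exact D.embed_injective this

/-- The solution in the interaction picture is the primitive of a continuous function. -/
theorem exists_primitive (h : D.IsMild v₀ T ψ) {b : ℝ} (hb : b ∈ timeInterval T) :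
    ∃ F : ℝ → E, Continuous F ∧ (∀ s ∈ Icc 0 b, F s = D.U (-s) (D.N (D.embed (ψ s)))) ∧
      ∀ s ∈ Icc 0 b, D.U (-s) (D.embed (ψ s)) = D.embed v₀ + ∫ r in (0 : ℝ)..s, F r := by
  obtain ⟨F, hF, hFe⟩ := exists_continuous_extension hb.1
    (h.continuousOn_U_N.mono (Icc_subset_timeInterval hb))
  refine ⟨F, hF, hFe, fun s hs => ?_⟩
  rw [h.U_neg_embed (Icc_subset_timeInterval hb hs)]
  congr 1
  refine intervalIntegral.integral_congr fun r hr => ?_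
  rw [uIcc_of_le hs.1] at hr
  exact (hFe r ⟨hr.1, hr.2.trans hs.2⟩).symm

/-- Uniqueness of mild solutions. -/
theorem eqOn {S : EReal} {φ : ℝ → V} (h : D.IsMild v₀ T ψ) (h' : D.IsMild v₀ S φ) {t : ℝ}
    (ht : t ∈ timeInterval T) (ht' : t ∈ timeInterval S) : ψ t = φ t := by
  have hsub := Icc_subset_timeInterval ht
  have hsub' := Icc_subset_timeInterval ht'
  obtain ⟨R₁, hR₁⟩ := isCompact_Icc.exists_bound_of_continuousOn (h.continuousOn.mono hsub)
  obtain ⟨R₂, hR₂⟩ := isCompact_Icc.exists_bound_of_continuousOn (h'.continuousOn.mono hsub')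
  set R := max R₁ R₂
  obtain ⟨L, hL⟩ := D.exists_lipschitz R
  obtain ⟨F, hF, hFe, hFi⟩ := h.exists_primitive ht
  obtain ⟨G, hG, hGe, hGi⟩ := h'.exists_primitive ht'
  -- In the interaction picture both curves solve `x' = U(-s) N(U(s) x)` in `E`. As `U` is
  -- isometric, this field is `L`-Lipschitz on the points that `U(s)` sends into the `V`-ball of
  -- radius `R`, where both curves stay.
  have key := ODE_solution_unique_of_mem_Icc_right (a := 0) (b := t) (K := L)
    (v := fun s x => D.U (-s) (D.N (D.U s x)))
    (s := fun s => {x | D.U s x ∈ D.embed '' Metric.closedBall 0 R})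
    (f := fun s => D.embed v₀ + ∫ r in (0 : ℝ)..s, F r)
    (g := fun s => D.embed v₀ + ∫ r in (0 : ℝ)..s, G r) ?_ ?_ ?_ ?_ ?_ ?_ ?_ ?_
  · have h1 := key (right_mem_Icc.2 ht.1)
    simp only at h1
    rw [← hFi t (right_mem_Icc.2 ht.1), ← hGi t (right_mem_Icc.2 ht.1)] at h1
    have h2 := congrArg (D.U t) h1
    rw [U_U_neg, U_U_neg] at h2
    exact D.embed_injective h2
  · intro s _
    refine LipschitzOnWith.of_dist_le_mul fun x hx y hy => ?_
    rw [dist_eq_norm, dist_eq_norm, ← map_sub, D.norm_U, ← D.norm_U s (x - y), map_sub,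
      ← dist_eq_norm, ← dist_eq_norm]
    exact hL.dist_le_mul _ hx _ hy
  · exact (continuous_const.add (intervalIntegral.continuous_primitive
      (fun a b => hF.intervalIntegrable a b) 0)).continuousOn
  · intro s hs
    have hs' := Ico_subset_Icc_self hs
    rw [← hFi s hs', U_U_neg, ← hFe s hs']
    exact ((hF.integral_hasStrictDerivAt 0 s).hasDerivAt.const_add _).hasDerivWithinAt
  · intro s hs
    have hs' := Ico_subset_Icc_self hs
    rw [← hFi s hs', mem_ofPred_eq, U_U_neg]
    exact mem_image_of_mem _ (mem_closedBall_zero_iff.2 ((hR₁ s hs').trans (le_max_left _ _)))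
  · exact (continuous_const.add (intervalIntegral.continuous_primitive
      (fun a b => hG.intervalIntegrable a b) 0)).continuousOn
  · intro s hs
    have hs' := Ico_subset_Icc_self hs
    rw [← hGi s hs', U_U_neg, ← hGe s hs']
    exact ((hG.integral_hasStrictDerivAt 0 s).hasDerivAt.const_add _).hasDerivWithinAt
  · intro s hs
    have hs' := Ico_subset_Icc_self hs
    rw [← hGi s hs', mem_ofPred_eq, U_U_neg]
    exact mem_image_of_mem _ (mem_closedBall_zero_iff.2 ((hR₂ s hs').trans (le_max_right _ _)))
  · simp

/-- Concatenation of mild solutions. -/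
theorem concat {φ : ℝ → V} {b τ : ℝ} (h : D.IsMild v₀ T ψ) (hb : b ∈ timeInterval T)
    (hτ : 0 < τ) (h' : D.IsMild (ψ b) τ φ) : ∃ χ, D.IsMild v₀ ((b + τ : ℝ) : EReal) χ := by
  have hφ0 : φ 0 = ψ b := h'.apply_zero (by exact_mod_cast hτ)
  -- A formula without cases: continuity is immediate, and `φ 0 = ψ b` gives the two restrictions.
  set χ : ℝ → V := fun t => ψ (min t b) + φ (max (t - b) 0) - ψ b with hχ
  have e1 : ∀ t, t ≤ b → χ t = ψ t := fun t ht => by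
    rw [hχ]
    simp only
    rw [min_eq_left ht, max_eq_right (by linarith), hφ0]
    abel
  have e2 : ∀ t, b ≤ t → χ t = φ (t - b) := fun t ht => by
    rw [hχ]
    simp only
    rw [min_eq_right ht, max_eq_left (by linarith)]
    abel
  have m1 : MapsTo (fun t => min t b) (timeInterval ((b + τ : ℝ) : EReal)) (timeInterval T) :=
    fun t ht => Icc_subset_timeInterval hb ⟨le_min ht.1 hb.1, min_le_right _ _⟩
  have m2 : MapsTo (fun t => max (t - b) 0) (timeInterval ((b + τ : ℝ) : EReal))
      (timeInterval (τ : EReal)) := fun t ht => by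
    rw [mem_timeInterval_coe] at ht ⊢
    exact ⟨le_max_right _ _, max_lt (by linarith) hτ⟩
  have hc : ContinuousOn χ (timeInterval ((b + τ : ℝ) : EReal)) :=
    ((h.continuousOn.comp (by fun_prop) m1).add (h'.continuousOn.comp (by fun_prop) m2)).sub
      continuousOn_const
  refine ⟨χ, hc, fun t ht => ?_⟩
  rcases le_or_gt t b with htb | htb
  · rw [e1 t htb, h.duhamel t (Icc_subset_timeInterval hb ⟨ht.1, htb⟩)]
    congr 1
    refine intervalIntegral.integral_congr fun s hs => ?_
    rw [uIcc_of_le ht.1] at hs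
    rw [e1 s (hs.2.trans htb)]
  · have hc' : ContinuousOn (fun s => D.U (t - s) (D.N (D.embed (χ s)))) (Icc 0 t) :=
      D.continuous_U_uncurry.comp_continuousOn ((continuousOn_const.sub continuousOn_id).prodMk
        (D.continuous_N_embed.comp_continuousOn (hc.mono (Icc_subset_timeInterval ht))))
    have i1 : IntervalIntegrable (fun s => D.U (t - s) (D.N (D.embed (χ s)))) volume 0 b :=
      ContinuousOn.intervalIntegrable (hc'.mono (by
        rw [uIcc_of_le hb.1]
        exact Icc_subset_Icc_right htb.le))
    have i2 : IntervalIntegrable (fun s => D.U (t - s) (D.N (D.embed (χ s)))) volume b t :=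
      ContinuousOn.intervalIntegrable (hc'.mono (by
        rw [uIcc_of_le htb.le]
        exact Icc_subset_Icc_left hb.1))
    -- The history up to `b` enters only through `U(t - b)` applied to the Duhamel term at `b`; the
    -- rest is a time shift.
    have j1 : ∫ s in (0 : ℝ)..b, D.U (t - s) (D.N (D.embed (χ s))) =
        D.U (t - b) (∫ s in (0 : ℝ)..b, D.U (b - s) (D.N (D.embed (ψ s)))) := by
      rw [← (D.U (t - b)).intervalIntegral_comp_comm (h.intervalIntegrable_sub hb b)]
      refine intervalIntegral.integral_congr fun s hs => ?_
      rw [uIcc_of_le hb.1] at hs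
      rw [e1 s hs.2, ← D.U_add, sub_add_sub_cancel]
    have j2 : ∫ s in b..t, D.U (t - s) (D.N (D.embed (χ s))) =
        ∫ s in (0 : ℝ)..(t - b), D.U (t - b - s) (D.N (D.embed (φ s))) := by
      have := intervalIntegral.integral_comp_sub_right (a := b) (b := t)
        (fun s => D.U (t - b - s) (D.N (D.embed (φ s)))) b
      rw [sub_self] at this
      rw [← this]
      refine intervalIntegral.integral_congr fun s hs => ?_
      rw [uIcc_of_le htb.le] at hs
      rw [e2 s hs.1, sub_sub_sub_cancel_right]
    rw [← intervalIntegral.integral_add_adjacent_intervals i1 i2, j1, j2, e2 t htb.le,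
      h'.duhamel (t - b) (mem_timeInterval_coe.2 ⟨by linarith, by
        linarith [(mem_timeInterval_coe.1 ht).2]⟩), h.duhamel b hb, map_add, ← D.U_add,
      sub_add_cancel]
    abel

end IsMild

end SemilinearFlow

/-! ### Local existence, maximal solutions and regularity in the dual -/

namespace SemilinearFlow

variable {E V : Type*} [NormedAddCommGroup E] [InnerProductSpace ℂ E] [CompleteSpace E]
  [NormedAddCommGroup V] [InnerProductSpace ℂ V] (D : SemilinearFlow E V)

/-- Local existence, with a time of existence that depends only on the norm of the initial value. -/
theorem exists_isMild [CompleteSpace V] (R : ℝ) :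
    ∃ τ : ℝ, 0 < τ ∧ ∀ v₀, ‖v₀‖ ≤ R → ∃ ψ, D.IsMild v₀ τ ψ := by
  rcases lt_or_ge R 0 with hR | hR
  · exact ⟨1, one_pos, fun v hv => absurd (norm_nonneg v) (by linarith)⟩
  have hC := D.bound_nonneg
  -- Interaction-picture curves may grow from radius `R` to `R + 1`; applying `U` costs the factor
  -- `D.bound`.
  set R₁ := D.bound * (R + 1) with hR₁
  obtain ⟨M, hM⟩ := D.exists_mapsTo R₁
  obtain ⟨L, hL⟩ := D.exists_lipschitz R₁
  set M' := D.bound * max M 0 with hM'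
  have hM0 : 0 ≤ M' := mul_nonneg hC (le_max_right _ _)
  have hden : 0 < M' + 2 * L + 1 := by positivity
  -- This `τ` serves two purposes: `M' * τ ≤ 1` keeps the integral within the extra unit of radius,
  -- and `L * τ ≤ 1 / 2` gives the contraction.
  set τ := 1 / (M' + 2 * L + 1) with hτdef
  have hτ : 0 < τ := by positivity
  have hτM : M' * τ ≤ 1 := by
    rw [hτdef, mul_one_div, div_le_one hden]
    linarith [L.coe_nonneg]
  have hτL : L * τ ≤ 1 / 2 := by
    rw [hτdef, mul_one_div, div_le_div_iff₀ hden two_pos]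
    linarith
  refine ⟨τ, hτ, fun v₀ hv₀ => ?_⟩
  let B : ℝ → Set E := fun r => D.embed '' Metric.closedBall 0 r
  -- Bounded in `V` but metrized by the sup distance in `E`, the only norm in which `N` is assumed
  -- Lipschitz.
  let S : Set C(Icc (0 : ℝ) τ, E) := {w | ∀ t, w t ∈ B (R + 1)}
  have hS : IsClosed S := by
    have : S = ⋂ t, (fun w : C(Icc (0 : ℝ) τ, E) => w t) ⁻¹' B (R + 1) := by
      ext w
      rw [mem_iInter]
      rfl
    rw [this]
    exact isClosed_iInter fun t =>
      (isClosed_image_closedBall D.embed_injective (by linarith)).preimage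
        (continuous_eval_const t)
  have : CompleteSpace S := hS.completeSpace_coe
  let ext : C(Icc (0 : ℝ) τ, E) → ℝ → E := fun w => IccExtend hτ.le w
  have hext : ∀ w, Continuous (ext w) := fun w => w.continuous.Icc_extend'
  let g : C(Icc (0 : ℝ) τ, E) → ℝ → E := fun w s => D.U (-s) (D.N (D.U s (ext w s)))
  have hextS : ∀ w ∈ S, ∀ s, ext w s ∈ B (R + 1) := fun w hw s => hw _
  have hUS : ∀ w ∈ S, ∀ s, D.U s (ext w s) ∈ B R₁ := fun w hw s =>
    D.U_mem_image_closedBall s (hextS w hw s)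
  have hg : ∀ w ∈ S, Continuous (g w) := fun w hw =>
    D.continuous_U_uncurry.comp (continuous_neg.prodMk
      (hL.continuousOn.comp_continuous (D.continuous_U_uncurry.comp
        (continuous_id.prodMk (hext w))) (hUS w hw)))
  have hgB : ∀ w ∈ S, ∀ s, g w s ∈ B M' := fun w hw s =>
    D.U_mem_image_closedBall (-s) (image_closedBall_mono (le_max_left _ _) (hM (hUS w hw s)))
  have hgI : ∀ w ∈ S, ∀ a b, ∫ s in a..b, g w s ∈ B (M' * |b - a|) := fun w hw a b =>
    integral_mem_image_closedBall D.embed_injective hM0 (hg w hw) fun s _ => hgB w hw s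
  have hv₀B : D.embed v₀ ∈ B R := ⟨v₀, mem_closedBall_zero_iff.2 hv₀, rfl⟩
  let Φ : S → S := fun w =>
    ⟨⟨fun t => D.embed v₀ + ∫ s in (0 : ℝ)..t, g w s,
      (continuous_const.add (intervalIntegral.continuous_primitive
        (fun a b => (hg w w.2).intervalIntegrable a b) 0)).comp continuous_subtype_val⟩, fun t => by
      refine image_closedBall_mono ?_ (add_mem_image_closedBall hv₀B (hgI w w.2 0 t))
      rw [sub_zero, abs_of_nonneg t.2.1]
      have := mul_le_mul_of_nonneg_left t.2.2 hM0
      linarith⟩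
  have hΦ : ContractingWith (1 / 2) Φ := by
    refine ⟨by rw [← NNReal.coe_lt_coe]; norm_num, LipschitzWith.of_dist_le_mul fun w w' => ?_⟩
    rw [Subtype.dist_eq, ContinuousMap.dist_le (by positivity)]
    intro t
    have h1 : (Φ w : C(Icc (0 : ℝ) τ, E)) t - (Φ w' : C(Icc (0 : ℝ) τ, E)) t =
        ∫ s in (0 : ℝ)..t, (g w s - g w' s) := by
      rw [intervalIntegral.integral_sub ((hg w w.2).intervalIntegrable _ _)
        ((hg w' w'.2).intervalIntegrable _ _)]
      exact add_sub_add_left_eq_sub _ _ _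
    rw [dist_eq_norm, h1]
    have h2 : ∀ s ∈ uIoc (0 : ℝ) t, ‖g w s - g w' s‖ ≤ L * dist w w' := fun s _ => by
      rw [← map_sub, D.norm_U, ← dist_eq_norm]
      refine (hL.dist_le_mul _ (hUS w w.2 s) _ (hUS w' w'.2 s)).trans ?_
      rw [dist_eq_norm, ← map_sub, D.norm_U, ← dist_eq_norm]
      gcongr
      exact ContinuousMap.dist_apply_le_dist _
    refine (intervalIntegral.norm_integral_le_of_norm_le_const h2).trans ?_
    rw [sub_zero, abs_of_nonneg t.2.1]
    calc L * dist w w' * t ≤ L * dist w w' * τ := by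
          gcongr
          exact t.2.2
      _ = L * τ * dist w w' := by ring
      _ ≤ 1 / 2 * dist w w' := by gcongr
      _ = _ := by norm_num
  have : Nonempty S := ⟨⟨ContinuousMap.const _ (D.embed v₀), fun _ =>
    image_closedBall_mono (by linarith) hv₀B⟩⟩
  obtain ⟨w, hw⟩ : ∃ w, Φ w = w := ⟨_, hΦ.fixedPoint_isFixedPt⟩
  have hfix : ∀ t ∈ Icc 0 τ, ext w t = D.embed v₀ + ∫ s in (0 : ℝ)..t, g w s := fun t ht => by
    have h1 := congrArg (fun x : S => (x : C(Icc (0 : ℝ) τ, E)) ⟨t, ht⟩) hw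
    simp only [ext]
    rw [IccExtend_of_mem hτ.le _ ht]
    exact h1.symm
  -- Lift the fixed point to `V`. Its increments are integrals of a `V`-bounded function, so `κ` is
  -- `M'`-Lipschitz into `V`, and `UV t (κ t)` is the desired `V`-continuous solution.
  choose κ _ hκe using hextS w w.2
  have hκc : ContinuousOn κ (Icc 0 τ) := by
    refine LipschitzOnWith.continuousOn (K := ⟨M', hM0⟩) (LipschitzOnWith.of_dist_le_mul
      fun t ht s hs => ?_)
    obtain ⟨z, hz, hze⟩ := hgI w w.2 s t
    have h1 : D.embed (κ t - κ s) = D.embed z := by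
      rw [map_sub, hκe, hκe, hfix t ht, hfix s hs, hze, add_sub_add_left_eq_sub,
        intervalIntegral.integral_interval_sub_left ((hg w w.2).intervalIntegrable _ _)
        ((hg w w.2).intervalIntegrable _ _)]
    rw [dist_eq_norm, D.embed_injective h1, Real.dist_eq]
    exact mem_closedBall_zero_iff.1 hz
  have hsub : timeInterval (τ : EReal) ⊆ Icc 0 τ := fun t ht =>
    ⟨ht.1, (mem_timeInterval_coe.1 ht).2.le⟩
  refine ⟨fun t => D.UV t (κ t), D.continuous_UV_uncurry.comp_continuousOn
    (continuousOn_id.prodMk (hκc.mono hsub)), fun t ht => ?_⟩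
  simp only [D.embed_UV, hκe]
  rw [integral_U_sub _ _ _ ((hg w w.2).intervalIntegrable _ _), ← map_add, hfix t (hsub ht)]

/-- The maximal mild solution and the blow-up alternative. -/
theorem exists_maximal [CompleteSpace V] (v₀ : V) : ∃ Tstar : EReal, 0 < Tstar ∧ ∃ ψmax, D.IsMild v₀ Tstar ψmax ∧
    (∀ T φ, D.IsMild v₀ T φ → T ≤ Tstar ∧ EqOn φ ψmax (timeInterval T)) ∧
    (Tstar = ⊤ ∨ ∃ b : ℝ, Tstar = b ∧ Tendsto (fun t => ‖ψmax t‖) (𝓝[<] b) atTop) := by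
  classical
  let P : ℝ → EReal × (ℝ → V) → Prop := fun t p => D.IsMild v₀ p.1 p.2 ∧ t ∈ timeInterval p.1
  set Tstar : EReal := sSup {T | ∃ φ, D.IsMild v₀ T φ} with hTs
  -- Any solution reaching `t` may supply the value; uniqueness makes the choice immaterial.
  let ψmax : ℝ → V := fun t => if h : ∃ p, P t p then h.choose.2 t else 0
  have hψ : ∀ T φ t, D.IsMild v₀ T φ → t ∈ timeInterval T → ψmax t = φ t := fun T φ t hφ ht => by
    have h : ∃ p, P t p := ⟨(T, φ), hφ, ht⟩
    simp only [ψmax, dif_pos h]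
    exact h.choose_spec.1.eqOn hφ h.choose_spec.2 ht
  have hle : ∀ T φ, D.IsMild v₀ T φ → T ≤ Tstar := fun T φ hφ => le_sSup ⟨φ, hφ⟩
  have hpos : 0 < Tstar := by
    obtain ⟨τ, hτ, h⟩ := D.exists_isMild ‖v₀‖
    obtain ⟨φ, hφ⟩ := h v₀ le_rfl
    exact lt_of_lt_of_le (by exact_mod_cast hτ) (hle _ φ hφ)
  have hmax : D.IsMild v₀ Tstar ψmax := by
    have key : ∀ t ∈ timeInterval Tstar, ∃ T φ, D.IsMild v₀ T φ ∧ t ∈ timeInterval T :=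
      fun t ht => by
        obtain ⟨T, ⟨φ, hφ⟩, hT⟩ := lt_sSup_iff.1 ht.2
        exact ⟨T, φ, hφ, ht.1, hT⟩
    refine ⟨fun t ht => ?_, fun t ht => ?_⟩
    · obtain ⟨T, φ, hφ, htT⟩ := key t ht
      have h1 : timeInterval T ∈ 𝓝[timeInterval Tstar] t := by
        obtain ⟨b, hb1, hb2⟩ := EReal.lt_iff_exists_real_btwn.1 htT.2
        filter_upwards [self_mem_nhdsWithin, mem_nhdsWithin_of_mem_nhds
          (Iio_mem_nhds (EReal.coe_lt_coe_iff.1 hb1))] with s hs hs'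
        exact ⟨hs.1, (EReal.coe_lt_coe_iff.2 hs').trans hb2⟩
      exact (((hφ.continuousOn t htT).congr (fun s hs => hψ T φ s hφ hs)
        (hψ T φ t hφ htT))).mono_of_mem_nhdsWithin h1
    · obtain ⟨T, φ, hφ, htT⟩ := key t ht
      rw [hψ T φ t hφ htT, hφ.duhamel t htT]
      congr 1
      refine intervalIntegral.integral_congr fun s hs => ?_
      rw [uIcc_of_le ht.1] at hs
      rw [hψ T φ s hφ (Icc_subset_timeInterval htT hs)]
  refine ⟨Tstar, hpos, ψmax, hmax, fun T φ hφ => ⟨hle T φ hφ, fun t ht => (hψ T φ t hφ ht).symm⟩, ?_⟩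
  induction hT : Tstar with
  | bot => exact absurd hpos (by rw [hT]; simp)
  | top => exact Or.inl rfl
  | coe b =>
    refine Or.inr ⟨b, rfl, tendsto_atTop.2 fun R => ?_⟩
    have hb : 0 < b := by
      rw [hT] at hpos
      exact_mod_cast hpos
    -- One `τ` works for all data of norm at most `R`, so a norm below `R` at a time in `(b - τ, b)`
    -- would give a solution living past `b`.
    obtain ⟨τ, hτ, h⟩ := D.exists_isMild R
    have h1 : Ioo (max 0 (b - τ)) b ∈ 𝓝[<] b :=
      Ioo_mem_nhdsLT (max_lt hb (by linarith))
    filter_upwards [h1] with t ht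
    by_contra hcon
    have ht' : t ∈ timeInterval Tstar := by
      rw [hT, mem_timeInterval_coe]
      exact ⟨(le_max_left _ _).trans ht.1.le, ht.2⟩
    obtain ⟨φ, hφ⟩ := h (ψmax t) (not_le.1 hcon).le
    obtain ⟨χ, hχ⟩ := hmax.concat ht' hτ hφ
    have h2 := hle _ χ hχ
    rw [hT, EReal.coe_le_coe_iff] at h2
    have := (le_max_right _ _).trans_lt ht.1
    linarith

variable {D}

theorem _root_.DeltaPrimeNLS.uniqueDiffOn_timeInterval (T : EReal) :
    UniqueDiffOn ℝ (timeInterval T) := by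
  induction T with
  | bot =>
    have : timeInterval ⊥ = ∅ := by
      ext t
      simp [timeInterval]
    rw [this]
    exact uniqueDiffOn_empty
  | top =>
    have : timeInterval ⊤ = Ici 0 := by
      ext t
      simp [timeInterval]
    rw [this]
    exact uniqueDiffOn_Ici 0
  | coe b =>
    have : timeInterval b = Ico 0 b := by
      ext t
      simp [timeInterval]
    rw [this]
    exact uniqueDiffOn_Ico 0 b

/-- A mild solution is continuously differentiable with values in the dual of `V`. -/
theorem IsMild.contDiffOn {v₀ : V} {T : EReal} {ψ : ℝ → V} (h : D.IsMild v₀ T ψ)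
    {G : E →L[ℂ] V} (hG : DenseRange G) {S : V →L[ℂ] V} {m : ℝ}
    (hS : ∀ u g, inner ℂ (S u) (G g) = inner ℂ (D.embed u) g)
    (hd : ∀ g t, HasDerivAt (fun t => D.U t (D.embed (G g)))
      (-(Complex.I • D.U t (g - (m : ℂ) • D.embed (G g)))) t)
    (hU : ∀ t x y, inner ℂ (D.U t x) (D.U t y) = inner ℂ x y) :
    ContDiffOn ℝ 1 (fun t => (innerSL ℂ (D.embed (ψ t))).comp D.embed) (timeInterval T) := by
  set J : V → StrongDual ℂ V := fun v => (innerSL ℂ (D.embed v)).comp D.embed with hJ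
  -- The candidate derivative `N(ψ) - iHψ` in the dual: `S` represents the form of `H + m`, and the
  -- last term removes the shift.
  set W : ℝ → StrongDual ℂ V := fun t => (innerSL ℂ (D.N (D.embed (ψ t)))).comp D.embed +
    innerSL ℂ (S (-Complex.I • ψ t)) -
    (innerSL ℂ ((m : ℂ) • D.embed (-Complex.I • ψ t))).comp D.embed with hW
  have hWc : ContinuousOn W (timeInterval T) := by
    have c1 : ContinuousOn (fun t => -Complex.I • ψ t) (timeInterval T) :=
      h.continuousOn.const_smul _
    have c2 : ContinuousOn (fun t => innerSL ℂ (D.N (D.embed (ψ t)))) (timeInterval T) :=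
      (innerSL ℂ).continuous.comp_continuousOn h.continuousOn_N
    have c3 : ContinuousOn (fun t => innerSL ℂ (S (-Complex.I • ψ t))) (timeInterval T) :=
      (innerSL ℂ).continuous.comp_continuousOn (S.continuous.comp_continuousOn c1)
    have c4 : ContinuousOn (fun t => innerSL ℂ ((m : ℂ) • D.embed (-Complex.I • ψ t)))
        (timeInterval T) :=
      (innerSL ℂ).continuous.comp_continuousOn
        ((D.embed.continuous.comp_continuousOn c1).const_smul _)
    exact ((c2.clm_comp continuousOn_const).add c3).sub (c4.clm_comp continuousOn_const)
  have key : ∀ b ∈ timeInterval T, ∀ W' : ℝ → StrongDual ℂ V, Continuous W' →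
      (∀ s ∈ Icc 0 b, W' s = W s) → ∀ s ∈ Icc 0 b, J (ψ s) = J v₀ + ∫ r in (0 : ℝ)..s, W' r := by
    intro b hb W' hW' hWe s hs
    obtain ⟨F, hF, hFe, hFi⟩ := h.exists_primitive hb
    have hfun : (fun v => J (ψ s) v) = fun v => (J v₀ + ∫ r in (0 : ℝ)..s, W' r) v := by
      refine hG.equalizer (J (ψ s)).continuous (ContinuousLinearMap.continuous _)
        (funext fun g => ?_)
      simp only [Function.comp_apply, add_apply]
      rw [ContinuousLinearMap.intervalIntegral_apply (hW'.intervalIntegrable _ _)]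
      -- Move the evolution to the test vector: `w r = U(-r) ψ(r)` is differentiable in `E`, and so
      -- is `U(-r) x` because `x` is in the range of the resolvent. The product rule then applies
      -- although `ψ` need not be differentiable in `E`.
      set w : ℝ → E := fun r => D.embed v₀ + ∫ q in (0 : ℝ)..r, F q with hw
      have hw' : ∀ r, HasDerivAt w (F r) r := fun r =>
        (hF.integral_hasStrictDerivAt 0 r).hasDerivAt.const_add _
      set x := D.embed (G g) with hx
      have hx' : ∀ r : ℝ, HasDerivAt (fun r => D.U (-r) x)
          (Complex.I • D.U (-r) (g - (m : ℂ) • x)) r := fun r => by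
        have := (hd g (-r)).scomp r (hasDerivAt_neg r)
        rw [neg_one_smul, neg_neg] at this
        exact this
      have hder : ∀ r, HasDerivAt (fun r => inner ℂ (w r) (D.U (-r) x))
          (inner ℂ (w r) (Complex.I • D.U (-r) (g - (m : ℂ) • x)) +
            inner ℂ (F r) (D.U (-r) x)) r := fun r => (hw' r).inner ℂ (hx' r)
      have hval : ∀ r ∈ Icc 0 b, inner ℂ (w r) (Complex.I • D.U (-r) (g - (m : ℂ) • x)) +
            inner ℂ (F r) (D.U (-r) x) = W' r (G g) := fun r hr => by
        rw [hWe r hr, hw]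
        simp only
        rw [← hFi r hr, hFe r hr, hU, ← map_smul, hU, hW]
        simp only [add_apply, sub_apply, ContinuousLinearMap.comp_apply, innerSL_apply_apply, hS]
        rw [← hx]
        simp only [map_smul, inner_smul_left, inner_smul_right, inner_sub_right, map_neg,
          Complex.conj_I, Complex.conj_ofReal]
        ring
      have hsub : uIcc 0 s ⊆ Icc 0 b := by
        rw [uIcc_of_le hs.1]
        exact Icc_subset_Icc_right hs.2
      have hint := intervalIntegral.integral_eq_sub_of_hasDerivAt (a := 0) (b := s)
        (f := fun r => inner ℂ (w r) (D.U (-r) x)) (f' := fun r => W' r (G g))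
        (fun r hr => (hder r).congr_deriv (hval r (hsub hr)))
        ((hW'.clm_apply continuous_const).intervalIntegrable _ _)
      rw [hint, hw]
      simp only
      rw [← hFi s hs, hU, intervalIntegral.integral_same, add_zero, neg_zero, D.U_zero]
      simp only [hJ, ContinuousLinearMap.comp_apply, innerSL_apply_apply]
      rw [← hx]
      ring
    exact ContinuousLinearMap.ext fun v => congrFun hfun v
  have hderiv : ∀ t ∈ timeInterval T,
      HasDerivWithinAt (fun t => J (ψ t)) (W t) (timeInterval T) t := by
    intro t ht
    obtain ⟨b, hb1, hb2⟩ := EReal.lt_iff_exists_real_btwn.1 ht.2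
    have htb : t < b := EReal.coe_lt_coe_iff.1 hb1
    have hb : b ∈ timeInterval T := ⟨ht.1.trans htb.le, hb2⟩
    obtain ⟨W', hW', hWe⟩ := exists_continuous_extension hb.1
      (hWc.mono (Icc_subset_timeInterval hb))
    have h1 := key b hb W' hW' hWe
    have h2 : HasDerivAt (fun s => J v₀ + ∫ r in (0 : ℝ)..s, W' r) (W' t) t :=
      (hW'.integral_hasStrictDerivAt 0 t).hasDerivAt.const_add _
    rw [hWe t ⟨ht.1, htb.le⟩] at h2
    refine h2.hasDerivWithinAt.congr_of_eventuallyEq ?_ (h1 t ⟨ht.1, htb.le⟩)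
    filter_upwards [self_mem_nhdsWithin, mem_nhdsWithin_of_mem_nhds (Iio_mem_nhds htb)] with s hs hs'
    exact h1 s ⟨hs.1, le_of_lt hs'⟩
  have hu := uniqueDiffOn_timeInterval T
  rw [show (1 : WithTop ℕ∞) = 0 + 1 from (zero_add 1).symm, contDiffOn_succ_iff_derivWithin hu]
  refine ⟨fun t ht => (hderiv t ht).differentiableWithinAt, by simp, contDiffOn_zero.2 ?_⟩
  exact hWc.congr fun t ht => (hderiv t ht).derivWithin (hu t ht)

end SemilinearFlow

/-! ### The power nonlinearity -/

/-- The function `z ↦ |z|^p z`. -/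
def powC (p : ℝ) (z : ℂ) : ℂ := ((‖z‖ ^ p : ℝ) : ℂ) * z

/-- The factor `b` compensates the singular derivative of `b ^ p` at `0` when `p < 1`. Using `log x
≤ x - 1` twice gives `1 - (b/a)^p ≤ p log (a/b) ≤ p (a/b - 1)`. -/
theorem rpow_sub_rpow_mul_le {p a b : ℝ} (hp : 0 < p) (hb : 0 ≤ b) (hab : b ≤ a) :
    (a ^ p - b ^ p) * b ≤ p * a ^ p * (a - b) := by
  rcases hb.eq_or_lt with rfl | hb
  · rw [mul_zero]
    have := Real.rpow_nonneg hab p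
    positivity
  have ha : 0 < a := hb.trans_le hab
  have h1 : 1 - (b / a) ^ p ≤ p * (a / b - 1) := by
    have e1 := Real.log_le_sub_one_of_pos (Real.rpow_pos_of_pos (div_pos hb ha) p)
    have e2 := Real.log_le_sub_one_of_pos (div_pos ha hb)
    rw [Real.log_rpow (div_pos hb ha)] at e1
    have e3 : Real.log (b / a) = - Real.log (a / b) := by rw [← Real.log_inv, inv_div]
    rw [e3] at e1
    nlinarith
  have h2 : b ^ p = a ^ p * (b / a) ^ p := by
    rw [← Real.mul_rpow ha.le (div_pos hb ha).le, mul_div_cancel₀ _ ha.ne']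
  have h3 : p * a ^ p * (a - b) = a ^ p * (p * (a / b - 1)) * b := by
    field_simp
  rw [h2, h3]
  refine mul_le_mul_of_nonneg_right ?_ hb.le
  have := mul_le_mul_of_nonneg_left h1 (Real.rpow_nonneg ha.le p)
  linarith

/-- Split off the larger modulus: the change of phase and size costs `M ^ p`, the change of weight
`p * M ^ p`. -/
theorem norm_powC_sub_le {p M : ℝ} (hp : 0 < p) {z w : ℂ} (hz : ‖z‖ ≤ M) (hw : ‖w‖ ≤ M) :
    ‖powC p z - powC p w‖ ≤ (p + 1) * M ^ p * ‖z - w‖ := by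
  wlog h : ‖w‖ ≤ ‖z‖ generalizing z w
  · rw [norm_sub_rev, norm_sub_rev z]
    exact this hw hz (not_le.1 h).le
  have h0 : 0 ≤ ‖z‖ ^ p := Real.rpow_nonneg (norm_nonneg _) _
  have h1 : powC p z - powC p w = ((‖z‖ ^ p : ℝ) : ℂ) * (z - w) +
      ((‖z‖ ^ p - ‖w‖ ^ p : ℝ) : ℂ) * w := by
    simp only [powC]
    push_cast
    ring
  have h2 : 0 ≤ ‖z‖ ^ p - ‖w‖ ^ p :=
    sub_nonneg.2 (Real.rpow_le_rpow (norm_nonneg _) h hp.le)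
  have h3 : ‖z‖ ^ p ≤ M ^ p := Real.rpow_le_rpow (norm_nonneg _) hz hp.le
  have h4 := rpow_sub_rpow_mul_le hp (norm_nonneg w) h
  have h5 : ‖z‖ - ‖w‖ ≤ ‖z - w‖ := norm_sub_norm_le z w
  rw [h1]
  refine (norm_add_le _ _).trans ?_
  rw [norm_mul, norm_mul, Complex.norm_real, Complex.norm_real, Real.norm_of_nonneg h0,
    Real.norm_of_nonneg h2]
  calc ‖z‖ ^ p * ‖z - w‖ + (‖z‖ ^ p - ‖w‖ ^ p) * ‖w‖
      ≤ ‖z‖ ^ p * ‖z - w‖ + p * ‖z‖ ^ p * ‖z - w‖ := by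
        refine add_le_add_right (h4.trans ?_) _
        gcongr
    _ = (p + 1) * ‖z‖ ^ p * ‖z - w‖ := by ring
    _ ≤ (p + 1) * M ^ p * ‖z - w‖ := by gcongr

theorem norm_powC_le {p M : ℝ} (hp : 0 < p) {z : ℂ} (hz : ‖z‖ ≤ M) :
    ‖powC p z‖ ≤ M ^ p * ‖z‖ := by
  rw [powC, norm_mul, Complex.norm_real,
    Real.norm_of_nonneg (Real.rpow_nonneg (norm_nonneg _) _)]
  exact mul_le_mul_of_nonneg_right (Real.rpow_le_rpow (norm_nonneg _) hz hp.le) (norm_nonneg _)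

theorem continuous_powC {p : ℝ} (hp : 0 < p) : Continuous (powC p) :=
  (Complex.continuous_ofReal.comp (continuous_norm.rpow_const fun _ => Or.inr hp.le)).mul
    continuous_id

/-- Elements of the energy space have bounded absolutely continuous representatives. -/
theorem exists_bounded_isPiecewisePrimitive (u : EnergySpace) :
    ∃ pR pL, IsPiecewisePrimitive (toL2 u) (energyDeriv u) pR ((Ioi 0).indicator (energyDeriv u))
      pL ((Iio 0).indicator (energyDeriv u)) ∧ (∀ x, ‖pR x‖ ≤ ‖u‖) ∧ ∀ x, ‖pL x‖ ≤ ‖u‖ := by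
  obtain ⟨pR, pL, h⟩ := (isWeakDeriv_energyDeriv u).exists_isPiecewisePrimitive
  have hb : 1 * ‖toL2 u‖ ^ 2 + ‖energyDeriv u‖ ^ 2 / 1 = ‖u‖ ^ 2 := by
    rw [norm_sq_eq_add]
    ring
  have hR : ∀ x, 0 ≤ x → ‖pR x‖ ≤ ‖u‖ := fun x hx => by
    have := h.norm_sq_right_le hx one_pos
    rw [hb] at this
    exact (sq_le_sq₀ (norm_nonneg _) (norm_nonneg _)).1 this
  have hL : ∀ x, x ≤ 0 → ‖pL x‖ ≤ ‖u‖ := fun x hx => by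
    have := h.norm_sq_left_le hx one_pos
    rw [hb] at this
    exact (sq_le_sq₀ (norm_nonneg _) (norm_nonneg _)).1 this
  refine ⟨pR, pL, h, fun x => ?_, fun x => ?_⟩
  · rcases le_total 0 x with hx | hx
    · exact hR x hx
    -- The right representative is constant on the negative axis, its derivative being cut off
    -- there, so the bound at `0` covers it.
    · have h1 := h.right.sub_eq x 0
      rw [intervalIntegral.integral_zero_ae (Eventually.of_forall fun t ht => by
        rw [uIoc_of_le hx] at ht
        exact indicator_of_notMem (by simpa using ht.2) _), sub_eq_zero] at h1
      rw [← h1]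
      exact hR 0 le_rfl
  · rcases le_total x 0 with hx | hx
    · exact hL x hx
    · have h1 := h.left.sub_eq 0 x
      rw [intervalIntegral.integral_zero_ae (Eventually.of_forall fun t ht => by
        rw [uIoc_of_le hx] at ht
        exact indicator_of_notMem (by simpa using ht.1.le) _), sub_eq_zero] at h1
      rw [h1]
      exact hL 0 le_rfl

theorem ae_norm_le (u : EnergySpace) : ∀ᵐ x, ‖toL2 u x‖ ≤ ‖u‖ := by
  obtain ⟨pR, pL, h, hR, hL⟩ := exists_bounded_isPiecewisePrimitive u
  filter_upwards [h.eq_right, h.eq_left, Measure.ae_ne volume (0 : ℝ)] with x a b hx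
  rcases lt_or_gt_of_ne hx with h0 | h0
  · rw [b h0]
    exact hL x
  · rw [a h0]
    exact hR x

section Nonlinearity

variable {μ : ℝ}

theorem memLp_powFun (hμ : 0 < μ) (u : EnergySpace) :
    MemLp (powFun μ (toL2 u)) 2 (volume : Measure ℝ) := by
  refine MemLp.of_le_mul (c := ‖u‖ ^ (2 * μ)) (Lp.memLp (toL2 u))
    ((continuous_powC (p := 2 * μ) (by positivity)).comp_aestronglyMeasurable
      (Lp.aestronglyMeasurable _)) ?_
  filter_upwards [ae_norm_le u] with x hx
  exact norm_powC_le (by positivity) hx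

theorem coeFn_nonlinearity (hμ : 0 < μ) (u : EnergySpace) :
    nonlinearity μ (toL2 u) =ᵐ[volume] powFun μ (toL2 u) := by
  rw [nonlinearity, dif_pos (memLp_powFun hμ u)]
  exact MemLp.coeFn_toLp _

theorem norm_nonlinearity_le (hμ : 0 < μ) {R : ℝ} {u : EnergySpace} (hu : ‖u‖ ≤ R) :
    ‖nonlinearity μ (toL2 u)‖ ≤ R ^ (2 * μ) * ‖toL2 u‖ := by
  refine Lp.norm_le_mul_norm_of_ae_le_mul ?_
  filter_upwards [ae_norm_le u, coeFn_nonlinearity hμ u] with x h1 h2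
  rw [h2]
  exact norm_powC_le (by positivity) (h1.trans hu)

theorem norm_nonlinearity_sub_le (hμ : 0 < μ) {R : ℝ} {u v : EnergySpace} (hu : ‖u‖ ≤ R)
    (hv : ‖v‖ ≤ R) : ‖nonlinearity μ (toL2 u) - nonlinearity μ (toL2 v)‖ ≤
      (2 * μ + 1) * R ^ (2 * μ) * ‖toL2 u - toL2 v‖ := by
  refine Lp.norm_le_mul_norm_of_ae_le_mul ?_
  filter_upwards [ae_norm_le u, coeFn_nonlinearity hμ u, ae_norm_le v, coeFn_nonlinearity hμ v,
    Lp.coeFn_sub (toL2 u) (toL2 v),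
    Lp.coeFn_sub (nonlinearity μ (toL2 u)) (nonlinearity μ (toL2 v))] with x h1 h2 h3 h4 h5 h6
  rw [h5, h6, Pi.sub_apply, Pi.sub_apply, h2, h4]
  exact norm_powC_sub_le (by positivity) (h1.trans hu) (h3.trans hv)

/-- The nonlinearity is bounded on bounded sets of the energy space. -/
theorem exists_energySpace_nonlinearity (hμ : 0 < μ) {R : ℝ} {u : EnergySpace} (hu : ‖u‖ ≤ R) :
    ∃ w : EnergySpace, toL2 w = nonlinearity μ (toL2 u) ∧
      ‖w‖ ≤ (2 * μ + 2) * R ^ (2 * μ) * R := by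
  classical
  have hR : 0 ≤ R := (norm_nonneg u).trans hu
  have hp : 0 < 2 * μ := by positivity
  obtain ⟨pR, pL, h, hbR, hbL⟩ := exists_bounded_isPiecewisePrimitive u
  have hRp : 0 ≤ R ^ (2 * μ) := Real.rpow_nonneg hR _
  set L := (2 * μ + 1) * R ^ (2 * μ) with hL
  have hL0 : 0 ≤ L := by positivity
  -- The representatives stay in the disc of radius `R`, where the power map is `L`-Lipschitz; hence
  -- the derivative of the composition is bounded by `L` times that of `u`.
  obtain ⟨kR, mR, eR, iR⟩ := h.right.comp_lipschitz (F := powC (2 * μ)) hL0 fun x y =>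
    norm_powC_sub_le hp ((hbR y).trans hu) ((hbR x).trans hu)
  obtain ⟨kL, mL, eL, iL⟩ := h.left.comp_lipschitz (F := powC (2 * μ)) hL0 fun x y =>
    norm_powC_sub_le hp ((hbL y).trans hu) ((hbL x).trans hu)
  have hk : ∀ᵐ x, ‖(Ioi (0 : ℝ)).piecewise kR kL x‖ ≤ L * ‖energyDeriv u x‖ := by
    filter_upwards [eR, eL, Measure.ae_ne volume (0 : ℝ)] with x a b hx
    rcases lt_or_gt_of_ne hx with h0 | h0
    · rw [piecewise_eq_of_notMem _ _ _ (by simpa using h0.le)]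
      rwa [indicator_of_mem (mem_Iio.2 h0)] at b
    · rw [piecewise_eq_of_mem _ _ _ (mem_Ioi.2 h0)]
      rwa [indicator_of_mem (mem_Ioi.2 h0)] at a
  have hmem : MemLp ((Ioi (0 : ℝ)).piecewise kR kL) 2 (volume : Measure ℝ) :=
    MemLp.of_le_mul (Lp.memLp (energyDeriv u))
      (mR.piecewise measurableSet_Ioi mL).aestronglyMeasurable hk
  have hw : IsPiecewisePrimitive (nonlinearity μ (toL2 u)) hmem.toLp
      (fun x => powC (2 * μ) (pR x)) kR (fun x => powC (2 * μ) (pL x)) kL :=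
    { right := iR
      left := iL
      eq_right := by
        filter_upwards [coeFn_nonlinearity hμ u, h.eq_right] with x a b hx
        rw [a, ← b hx]
        rfl
      deriv_eq_right := by
        filter_upwards [hmem.coeFn_toLp] with x a hx
        rw [a, piecewise_eq_of_mem _ _ _ (mem_Ioi.2 hx)]
      eq_left := by
        filter_upwards [coeFn_nonlinearity hμ u, h.eq_left] with x a b hx
        rw [a, ← b hx]
        rfl
      deriv_eq_left := by
        filter_upwards [hmem.coeFn_toLp] with x a hx
        rw [a, piecewise_eq_of_notMem _ _ _ (by simpa using hx.le)] }
  refine ⟨energyMk _ _ hw.isWeakDeriv, rfl, ?_⟩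
  have n1 := norm_nonlinearity_le hμ hu
  have n2 : ‖hmem.toLp‖ ≤ L * ‖energyDeriv u‖ := by
    refine Lp.norm_le_mul_norm_of_ae_le_mul ?_
    filter_upwards [hk, hmem.coeFn_toLp] with x a b
    rwa [b]
  have n3 : ‖energyDeriv u‖ ≤ R := by
    refine le_trans ?_ hu
    have := norm_sq_eq_add u
    nlinarith [norm_nonneg u, norm_nonneg (energyDeriv u), sq_nonneg ‖toL2 u‖]
  have n4 : ‖toL2 u‖ ≤ R := (norm_toL2_le u).trans hu
  have n5 := norm_sq_eq_add (energyMk _ _ hw.isWeakDeriv)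
  rw [toL2_energyMk, energyDeriv_energyMk] at n5
  have n6 : ‖energyMk _ _ hw.isWeakDeriv‖ ≤ ‖nonlinearity μ (toL2 u)‖ + ‖hmem.toLp‖ := by
    refine (sq_le_sq₀ (norm_nonneg _) (by positivity)).1 ?_
    nlinarith [norm_nonneg (nonlinearity μ (toL2 u)), norm_nonneg hmem.toLp]
  calc _ ≤ _ := n6
    _ ≤ R ^ (2 * μ) * ‖toL2 u‖ + L * ‖energyDeriv u‖ := add_le_add n1 n2
    _ ≤ R ^ (2 * μ) * R + L * R := by gcongr
    _ = (2 * μ + 2) * R ^ (2 * μ) * R := by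
        rw [hL]
        ring

end Nonlinearity

/-! ### The nonlinear Schrödinger equation -/

section NLS

variable {γ μ : ℝ}

/-- The nonlinear Schrödinger flow. -/
def nlsFlow (hγ : 0 < γ) (lam : ℝ) (hμ : 0 < μ) : SemilinearFlow L2R EnergySpace where
  embed := toL2
  embed_injective := toL2_injective
  U := propagator γ
  U_zero := (isUnitaryGroupOf_propagator hγ).apply_zero
  U_add := (isUnitaryGroupOf_propagator hγ).apply_add
  norm_U := (isUnitaryGroupOf_propagator hγ).norm_apply
  continuous_U := (isUnitaryGroupOf_propagator hγ).continuous
  UV := propagatorQ γ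
  bound := √(2 * ‖formOperator γ (formShift γ)‖)
  bound_nonneg := Real.sqrt_nonneg _
  norm_UV_le := norm_propagatorQ_le hγ
  embed_UV := toL2_propagatorQ hγ
  continuous_UV := continuous_propagatorQ hγ
  N := fun f => (Complex.I * lam) • nonlinearity μ f
  exists_mapsTo := fun R => ⟨|lam| * ((2 * μ + 2) * R ^ (2 * μ) * R), by
    rintro _ ⟨u, hu, rfl⟩
    rw [mem_closedBall_zero_iff] at hu
    obtain ⟨w, h1, h2⟩ := exists_energySpace_nonlinearity hμ hu
    refine ⟨(Complex.I * lam) • w, ?_, by rw [map_smul, h1]⟩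
    rw [mem_closedBall_zero_iff, norm_smul, norm_mul, Complex.norm_I, one_mul, Complex.norm_real,
      Real.norm_eq_abs]
    gcongr⟩
  exists_lipschitz := fun R => ⟨(|lam| * ((2 * μ + 1) * R ^ (2 * μ))).toNNReal,
    LipschitzOnWith.of_dist_le' (by
    rintro _ ⟨u, hu, rfl⟩ _ ⟨v, hv, rfl⟩
    rw [mem_closedBall_zero_iff] at hu hv
    rw [dist_eq_norm, dist_eq_norm, ← smul_sub, norm_smul, norm_mul, Complex.norm_I, one_mul,
      Complex.norm_real, Real.norm_eq_abs, mul_assoc]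
    gcongr
    exact norm_nonlinearity_sub_le hμ hu hv)⟩

/-- Continuity in `Q` and the Duhamel identity already imply square integrability, integrability in
time and differentiability in `Q⋆`. -/
theorem isSolution_iff_isMild (hγ : 0 < γ) (lam : ℝ) (hμ : 0 < μ) {ψ₀ : EnergySpace} {T : EReal}
    {ψ : ℝ → EnergySpace} :
    IsSolution γ lam μ ψ₀ T ψ ↔ (nlsFlow hγ lam hμ).IsMild ψ₀ T ψ := by
  have hint : ∀ t, ∫ s in (0 : ℝ)..t, propagator γ (t - s)
      ((Complex.I * lam) • nonlinearity μ (toL2 (ψ s))) = (Complex.I * (lam : ℂ)) •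
      ∫ s in (0 : ℝ)..t, propagator γ (t - s) (nonlinearity μ (toL2 (ψ s))) := fun t => by
    rw [← intervalIntegral.integral_smul]
    simp only [map_smul]
  constructor
  · intro h
    exact ⟨h.continuousOn, fun t ht => (h.duhamel t ht).trans (congrArg _ (hint t).symm)⟩
  · intro h
    -- The flow with coupling `1` is used so that multiplying by `-i` recovers the bare nonlinearity
    -- without dividing by `lam`.
    have hN : ContinuousOn (fun s => nonlinearity μ (toL2 (ψ s))) (timeInterval T) :=
      ((nlsFlow hγ 1 hμ).continuous_N_embed.comp_continuousOn h.continuousOn |>.const_smul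
        (-Complex.I)).congr fun s _ => by simp [nlsFlow, smul_smul]
    refine ⟨h.continuousOn, ?_, fun t _ => memLp_powFun hμ _, fun t ht => ?_, fun t ht =>
      (h.duhamel t ht).trans (congrArg _ (hint t))⟩
    · exact h.contDiffOn (denseRange_resolventQ hγ) (inner_resolventQ_formOperator hγ)
        (fun g t => (isUnitaryGroupOf_propagator hγ).hasDerivAt (resolvent_mem_graph hγ g) t)
        (isUnitaryGroupOf_propagator hγ).inner_apply_apply
    · refine ContinuousOn.intervalIntegrable (ContinuousOn.mono
        ((nlsFlow hγ lam hμ).continuous_U_uncurry.comp_continuousOn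
          ((continuousOn_const.sub continuousOn_id).prodMk hN)) ?_)
      rw [uIcc_of_le ht.1]
      exact Icc_subset_timeInterval ht

end NLS

end DeltaPrimeNLS

end

theorem proposition3p3 (γ lam μ : ℝ) (hγ : 0 < γ) (hlam : 0 < lam) (hμ : 0 < μ) :
    -- the propagator is the unitary group generated by the Hamiltonian
    DeltaPrimeNLS.IsUnitaryGroupOf (DeltaPrimeNLS.hamiltonian γ) (DeltaPrimeNLS.propagator γ) ∧
    ∀ ψ₀ : DeltaPrimeNLS.EnergySpace,
      -- local existence and uniqueness
      (∃ T : ℝ, 0 < T ∧ ∃ ψ : ℝ → DeltaPrimeNLS.EnergySpace,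
        DeltaPrimeNLS.IsSolution γ lam μ ψ₀ T ψ ∧
        ∀ φ : ℝ → DeltaPrimeNLS.EnergySpace, DeltaPrimeNLS.IsSolution γ lam μ ψ₀ T φ →
          Set.EqOn φ ψ (DeltaPrimeNLS.timeInterval T)) ∧
      -- the maximal solution, which extends every solution, and the blow-up alternative
      ∃ Tstar : EReal, 0 < Tstar ∧ ∃ ψmax : ℝ → DeltaPrimeNLS.EnergySpace,
        DeltaPrimeNLS.IsSolution γ lam μ ψ₀ Tstar ψmax ∧
        (∀ (T : EReal) (φ : ℝ → DeltaPrimeNLS.EnergySpace),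
          DeltaPrimeNLS.IsSolution γ lam μ ψ₀ T φ →
            T ≤ Tstar ∧ Set.EqOn φ ψmax (DeltaPrimeNLS.timeInterval T)) ∧
        (Tstar = ⊤ ∨ ∃ b : ℝ, Tstar = b ∧
          Filter.Tendsto (fun t => ‖ψmax t‖) (nhdsWithin b (Set.Iio b)) Filter.atTop) := by
  refine ⟨DeltaPrimeNLS.isUnitaryGroupOf_propagator hγ, fun ψ₀ => ?_⟩
  simp only [DeltaPrimeNLS.isSolution_iff_isMild hγ lam hμ]
  refine ⟨?_, (DeltaPrimeNLS.nlsFlow hγ lam hμ).exists_maximal ψ₀⟩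
  obtain ⟨τ, hτ, h⟩ := (DeltaPrimeNLS.nlsFlow hγ lam hμ).exists_isMild ‖ψ₀‖
  obtain ⟨ψ, hψ⟩ := h ψ₀ le_rfl
  exact ⟨τ, hτ, ψ, hψ, fun φ hφ t ht => hφ.eqOn hψ ht ht⟩
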